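/- **Setting (messages).** Messages are built freely from names, texts, random nonces, constant strings, asymmetric keys $k$ (with inverse $k^{-1}$; every name $a$ has a long-term pair $\mathrm{pubk}(a),\mathrm{privk}(a)$), exponents $e$ in the free abelian group generated by atomic Diffie–Hellman (DH) secrets, and DH values $g^e$, by pairing, encryption or signing $\{m\}_k$, and hashing. A message *carries* its content (not encryption keys, not the arguments of hashes). In a bundle (a finite acyclic set of initial parts of regular strands and of Dolev–Yao penetrator strands, without bound on their number, in which every reception is matched with a unique transmission of the same message by another strand) a term is *non-originating* if no message carries it; it *uniquely originates* on a strand $s$ if $s$ transmits it carried, having neither sent nor received it carried before, and this happens at no other node of the bundle; an atomic DH secret is *uniquely generated* on $s$ if the same holds with "occurs anywhere in the message" in place of "is carried". The penetrator can create atoms (names, texts, nonces, keys, DH secrets), pair, project, encrypt, decrypt, hash, duplicate and discard messages, multiply and invert exponents, and exponentiate. **Setting (protocols).** Let UAF-Endpoint-TLS1.2-DH, UAF-ServerCert-TLS1.2-DH and UAF-Exporter-TLS1.3 be the strand spaces with the roles client-reg, server-reg (complementary) and client-auth, server-auth (complementary). Each role first runs a TLS handshake with variables $server, ca, cr, sr,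 x, y$ (server and certificate-authority names, client and server randoms, client and server DH exponents; own exponents are atomic), in which the server presents a certificate $\mathrm{cert}$ for its public key $K$ signed with $\mathrm{privk}(ca)$; $K=\mathrm{pubk}(server)$ in TLS 1.2, and in TLS 1.3 $K$ is a separate variable $spk$. Every role declares its own DH exponent to be uniquely generated, and only bundles that respect these declarations are considered. - TLS 1.2 with DH: (1) client sends $cr$; (2) server sends $sr,\mathrm{cert},g^y,\{cr,sr,g^y\}_{K^{-1}}$; (3) client sends $g^x$ and its Finished message under $cwk$; (4) server sends its Finished message under $swk$. The write keys $cwk\ne swk$ are hashes of the master secret $ms=\mathrm{hash}(g^{xy},cr,sr)$ and of $cr,sr$ (with distinct labels), and the Finished messages are labelled hashes of $ms$ and the transcript. - TLS 1.3: (1) client sends $cr,g^x$; (2) server sends $sr,g^y$ and, under its handshake key, $\mathrm{cert}$, a signature with $K^{-1}$ on the hash of $cr,g^x,sr,g^y,\mathrm{cert}$, and Finished; (3) client sends Finished under its handshake key. The handshake keys are labelled hashes of the handshake secret $\mathrm{hash}(g^{xy})$ and of the hello messages; $ms$ is a labelled hash of the handshake secret, and $cwk$, $swk$ are labelled hashes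 of $ms$ and of the transcript up to the server's Finished. After the handshake, authentication is: server sends $\{appid,challenge\}_{swk}$; client sends $\{fc,n,\{fc,n\}_{K_{priv}}\}_{cwk}$, where $K_{priv}$ is the authenticator's private authentication key, $n$ a nonce and $fc=\mathrm{hash}(appid,challenge,tlsData)$. Registration is: server sends $\{username,appid,challenge\}_{swk}$; client sends $\{\mathrm{hash}(K_{priv},username),aaid,K_{pub},fc,\{aaid,fc,K_{pub}\}_{\mathrm{privk}(aaid)}\}_{cwk}$. Here $tlsData$ is a (labelled) hash of $challenge,\mathrm{hash}(\mathrm{cert})$ (Endpoint), of $challenge,\mathrm{cert}$ (ServerCert), or of $ms,cr,sr,K$ (Exporter). **Definitions.** Two strands *agree on the session context* if they have the same $server, ca, cr, sr, x, y$ (TLS context), $challenge$, $server$ and $appid$. The *server assumptions* for a server-auth strand $s$ in a bundle: $\mathrm{privk}(ca)$, $K^{-1}$ and $K_{priv}$ are non-originating; $sr$ and $challenge$ uniquely originate on $s$; $y$ is uniquely generated on $s$. Write $\mathrm{height}(R)$ for the number of messages of role $R$. For a role $R$ and a number $j$, $\mathrm{Succ}(R,j)$ means: for every bundle and every fully executed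 server-auth strand $s$ in it satisfying the server assumptions, there is in the bundle a strand $s'$ of role $R$, complementary to $s$, of height at least $j$, that agrees with $s$ on the session context. $\mathrm{Uniq}(j)$ means: for all roles $R,R'$, if $\mathrm{Succ}(R,j)$ and $\mathrm{Succ}(R',j)$ then $R=R'$. **Theorem 6.** In each of the three strand spaces the following hold. 1. (Goal 1, session context agreement.) There is $j\le\mathrm{height}(\text{client-auth})$ with $\mathrm{Succ}(\text{client-auth},j)$ and $\mathrm{Uniq}(j)$. 2. (Injective agreement, strand by strand.) For every bundle and every fully executed server-auth strand $s$ in it satisfying the server assumptions, there is in the bundle a fully executed client-auth strand $s'$ that agrees with $s$ on the session context, and no regular strand of the bundle other than $s$ and $s'$, of any role and executed up to the height of a full client-auth strand, agrees with $s$ on the session context. -/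

import Mathlib

namespace UAF

/-! ### Message algebra -/

abbrev Name := ℕ
abbrev Text := ℕ
/-- TLS randoms and other random nonces. -/
abbrev Rand := ℕ
/-- Atomic Diffie-Hellman secrets. -/
abbrev Rndx := ℕ

/-- Exponents: the free abelian group on the atomic secrets.  The group of exponents is written
additively, so `e + f` stands for the product of the exponents and `-e` for the inverse. -/
abbrev Expt := Rndx →₀ ℤ

/-- An atomic secret as an exponent. -/
noncomputable def rx (r : Rndx) : Expt := Finsupp.single r 1

/-- Identities of asymmetric key pairs: the long-term pair of a name, or any other pair. -/
inductive KeyId where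
  | named (a : Name)
  | free (k : ℕ)

/-- One half (public or private) of an asymmetric key pair. -/
structure AKey where
  id : KeyId
  priv : Bool

/-- The other half of the pair. -/
def AKey.inv (k : AKey) : AKey := ⟨k.id, !k.priv⟩

def pubk (a : Name) : AKey := ⟨.named a, false⟩
def privk (a : Name) : AKey := ⟨.named a, true⟩

/-- Constant strings. -/
inductive Tag where
  | masterSecret | clientWrite | serverWrite | clientFinished | serverFinished
  | handshakeSecret | clientHandshake | serverHandshake | certificateVerify | finished
  | uafServerEndpoint | uafServerCert | exporterChannelBinding

/-- Messages.  `dh e` is `g ^ e`; `expt e` is the exponent `e` itself.  `enc m k` is `m` under `k`: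
asymmetric encryption or signature when `k` is an asymmetric key, symmetric encryption otherwise. -/
inductive Msg where
  | name (a : Name)
  | text (t : Text)
  | rand (r : Rand)
  | tag (c : Tag)
  | akey (k : AKey)
  | expt (e : Expt)
  | dh (e : Expt)
  | pair (m₁ m₂ : Msg)
  | enc (m k : Msg)
  | hash (m : Msg)

infixr:65 " ⋄ " => Msg.pair

/-- The key that undoes encryption under the given key. -/
def Msg.inv : Msg → Msg
  | .akey k => .akey k.inv
  | m => m

/-- `Carried t m`: `t` is carried by `m`, that is, it is part of the content of `m`, disregarding
encryption keys and the arguments of hashes. -/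
inductive Carried (t : Msg) : Msg → Prop where
  | refl : Carried t t
  | left {m₁ m₂ : Msg} : Carried t m₁ → Carried t (m₁ ⋄ m₂)
  | right {m₁ m₂ : Msg} : Carried t m₂ → Carried t (m₁ ⋄ m₂)
  | body {m k : Msg} : Carried t m → Carried t (.enc m k)

/-- The atomic secret `r` occurs anywhere in the message. -/
def Occurs (r : Rndx) : Msg → Prop
  | .expt e => e r ≠ 0
  | .dh e => e r ≠ 0
  | .pair m₁ m₂ => Occurs r m₁ ∨ Occurs r m₂
  | .enc m k => Occurs r m ∨ Occurs r k
  | .hash m => Occurs r m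
  | _ => False

/-! ### Strands and bundles -/

inductive Event where
  | send (m : Msg)
  | recv (m : Msg)

def Event.msg : Event → Msg
  | .send m => m
  | .recv m => m

/-- Penetrator strands of the Dolev-Yao adversary. -/
inductive Pen where
  | name (a : Name)
  | text (t : Text)
  | rand (r : Rand)
  | tag (c : Tag)
  | key (k : AKey)
  | gen
  | rndx (r : Rndx)
  | mulExpt (e f : Expt)
  | invExpt (e : Expt)
  | exp (e f : Expt)
  | flush (m : Msg)
  | tee (m : Msg)
  | concat (m₁ m₂ : Msg)
  | separate (m₁ m₂ : Msg)
  | encrypt (m k : Msg)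
  | decrypt (m k : Msg)
  | hash (m : Msg)

noncomputable def Pen.trace : Pen → List Event
  | .name a => [.send (.name a)]
  | .text t => [.send (.text t)]
  | .rand r => [.send (.rand r)]
  | .tag c => [.send (.tag c)]
  | .key k => [.send (.akey k)]
  | .gen => [.send (.dh 0)]
  | .rndx r => [.send (.expt (rx r))]
  | .mulExpt e f => [.recv (.expt e), .recv (.expt f), .send (.expt (e + f))]
  | .invExpt e => [.recv (.expt e), .send (.expt (-e))]
  | .exp e f => [.recv (.dh e), .recv (.expt f), .send (.dh (e + f))]
  | .flush m => [.recv m]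
  | .tee m => [.recv m, .send m, .send m]
  | .concat m₁ m₂ => [.recv m₁, .recv m₂, .send (m₁ ⋄ m₂)]
  | .separate m₁ m₂ => [.recv (m₁ ⋄ m₂), .send m₁, .send m₂]
  | .encrypt m k => [.recv m, .recv k, .send (.enc m k)]
  | .decrypt m k => [.recv (.enc m k), .recv k.inv, .send m]
  | .hash m => [.recv m, .send (.hash m)]

/-- A protocol: its roles, the instances of the roles (a role with values for its variables), and
the trace of every instance.  `uniqGen s` holds the atomic secrets that the role of `s` declares to
be uniquely generated, and `compl` tells which roles are complementary. -/
structure Protocol where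
  Role : Type
  Inst : Type
  role : Inst → Role
  trace : Inst → List Event
  height : Role → ℕ
  length_trace : ∀ s, (trace s).length = height (role s)
  uniqGen : Inst → Set Rndx
  compl : Role → Role → Prop

/-- The strands of the strand space of a protocol. -/
inductive Strand (P : Protocol) where
  | regular (s : P.Inst)
  | penetrator (p : Pen)

noncomputable def Strand.trace {P : Protocol} : Strand P → List Event
  | .regular s => P.trace s
  | .penetrator p => p.trace

/-- A bundle: finitely many strands, each executed up to a positive height, where every reception
in the bundle is matched with a unique transmission of the same message on another strand, and
where the causal graph is acyclic.  A node is a strand of the bundle with a position on it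
(counted from 0). -/
structure Bundle (P : Protocol) where
  size : ℕ
  strand : Fin size → Strand P
  height : Fin size → ℕ
  height_pos : ∀ k, 0 < height k
  height_le : ∀ k, height k ≤ (strand k).trace.length
  comm : Fin size × ℕ → Fin size × ℕ → Prop
  comm_spec : ∀ a b, comm a b → a.2 < height a.1 ∧ b.2 < height b.1 ∧ a.1 ≠ b.1 ∧
    ∃ m, (strand a.1).trace[a.2]? = some (.send m) ∧ (strand b.1).trace[b.2]? = some (.recv m)
  recv_unique : ∀ b m, b.2 < height b.1 → (strand b.1).trace[b.2]? = some (.recv m) →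
    ∃! a, comm a b
  acyclic : ∀ a, ¬ Relation.TransGen
    (fun a b => comm a b ∨ (a.1 = b.1 ∧ a.2 + 1 = b.2 ∧ b.2 < height b.1)) a a

namespace Bundle

variable {P : Protocol} (B : Bundle P)

abbrev Node : Type := Fin B.size × ℕ

/-- The event at a node; `none` if the node does not belong to the bundle. -/
noncomputable def event (n : B.Node) : Option Event :=
  if n.2 < B.height n.1 then (B.strand n.1).trace[n.2]? else none

/-- `t` originates at `n`: `n` transmits a message that carries `t`, and no earlier message of the
strand carries `t`. -/
def Originates (n : B.Node) (t : Msg) : Prop :=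
  (∃ m, B.event n = some (.send m) ∧ Carried t m) ∧
    ∀ i < n.2, ∀ e, B.event (n.1, i) = some e → ¬ Carried t e.msg

/-- `r` generates at `n`: `n` transmits a message in which `r` occurs, and `r` occurs in no earlier
message of the strand. -/
def Generates (n : B.Node) (r : Rndx) : Prop :=
  (∃ m, B.event n = some (.send m) ∧ Occurs r m) ∧
    ∀ i < n.2, ∀ e, B.event (n.1, i) = some e → ¬ Occurs r e.msg

/-- `t` is non-originating: no message of the bundle carries it. -/
def NonOrig (t : Msg) : Prop :=
  ∀ n e, B.event n = some e → ¬ Carried t e.msg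

/-- `t` originates on the strand `k`, and at no other node of the bundle. -/
def UniqOrigOn (t : Msg) (k : Fin B.size) : Prop :=
  ∃ i, B.Originates (k, i) t ∧ ∀ n, B.Originates n t → n = (k, i)

/-- `r` generates on the strand `k`, and at no other node of the bundle. -/
def UniqGenOn (r : Rndx) (k : Fin B.size) : Prop :=
  ∃ i, B.Generates (k, i) r ∧ ∀ n, B.Generates n r → n = (k, i)

/-- The bundle respects the freshness declarations of the roles: a secret that the role of a
regular strand declares to be uniquely generated is uniquely generated on that strand, as soon as
the strand has been executed far enough for the secret to occur in it. -/
def RespectsRoles : Prop :=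
  ∀ k s, B.strand k = .regular s → ∀ r ∈ P.uniqGen s,
    (∃ i e, B.event (k, i) = some e ∧ Occurs r e.msg) → B.UniqGenOn r k

end Bundle

/-! ### Session context agreement -/

/-- A session context: the facts on which two strands have to agree. -/
abbrev Context (P : Protocol) := P.Inst → P.Inst → Prop

/-- Origination assumptions for a strand of a bundle, the given instance of a role. -/
abbrev Assumptions (P : Protocol) := (B : Bundle P) → Fin B.size → P.Inst → Prop

/-- Successful completion. -/
def Succ (P : Protocol) (Ra Rb : P.Role) (Ctx : Context P) (Orig : Assumptions P) (i j : ℕ) :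
    Prop :=
  ∀ B : Bundle P, B.RespectsRoles → ∀ k s, B.strand k = .regular s → P.role s = Ra →
    i ≤ B.height k → Orig B k s →
    ∃ k' s', B.strand k' = .regular s' ∧ P.role s' = Rb ∧ P.compl (P.role s) (P.role s') ∧
      j ≤ B.height k' ∧ Ctx s s'

/-- Unique completion. -/
def Uniq (P : Protocol) (Ra : P.Role) (Ctx : Context P) (Orig : Assumptions P) (i j : ℕ) : Prop :=
  ∀ Rb Rc : P.Role, Succ P Ra Rb Ctx Orig i j ∧ Succ P Ra Rc Ctx Orig i j → Rb = Rc

/-- Session context agreement between complementary roles. -/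
def SessionContextAgreement (P : Protocol) (Ra Rb : P.Role) (Ctx : Context P)
    (Orig : Assumptions P) : Prop :=
  ∃ j ≤ P.height Rb, Succ P Ra Rb Ctx Orig (P.height Ra) j ∧ Uniq P Ra Ctx Orig (P.height Ra) j

/-- Injective agreement, strand by strand: a fully executed strand of `Ra` has a fully executed
complementary strand of `Rb` that satisfies the context with it, and this is the only other regular
strand of the bundle, of any role and executed up to that height at least, that does so. -/
def InjectiveAgreement (P : Protocol) (Ra Rb : P.Role) (Ctx : Context P)
    (Orig : Assumptions P) : Prop :=
  ∀ B : Bundle P, B.RespectsRoles → ∀ k s, B.strand k = .regular s → P.role s = Ra →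
    P.height Ra ≤ B.height k → Orig B k s →
    ∃ k' s', B.strand k' = .regular s' ∧ P.role s' = Rb ∧ P.compl (P.role s) (P.role s') ∧
      P.height Rb ≤ B.height k' ∧ Ctx s s' ∧
      ∀ k'' s'', B.strand k'' = .regular s'' → k'' ≠ k → P.height Rb ≤ B.height k'' → Ctx s s'' →
        k'' = k'

/-! ### The UAF strand spaces -/

/-- TLS version and channel binding. -/
inductive Model where
  | endpointTLS12DH
  | serverCertTLS12DH
  | exporterTLS13

/-- The two ends of the TLS channel. -/
inductive Side where
  | client
  | server

/-- The roles. -/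
inductive Role where
  | clientReg
  | serverReg
  | clientAuth
  | serverAuth

/-- Complementary roles: the two ends of registration, and the two ends of authentication. -/
def Role.Compl : Role → Role → Prop
  | .clientReg, .serverReg => True
  | .serverReg, .clientReg => True
  | .clientAuth, .serverAuth => True
  | .serverAuth, .clientAuth => True
  | _, _ => False

/-- The TLS variables of a client: its own secret exponent is atomic, and the exponent of the
server's public value is arbitrary.  `spk` is the server's public key. -/
structure ClientTLS where
  server : Name
  ca : Name
  spk : AKey
  cr : Rand
  sr : Rand
  x : Rndx
  y : Expt

/-- The TLS variables of a server. -/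
structure ServerTLS where
  server : Name
  ca : Name
  spk : AKey
  cr : Rand
  sr : Rand
  x : Expt
  y : Rndx

/-- The TLS values of a session, as seen by either end. -/
structure TLS where
  server : Name
  ca : Name
  spk : AKey
  cr : Rand
  sr : Rand
  x : Expt
  y : Expt

/-- The variables of registration: `aaid` names the authenticator, `authk` is the public half of
the authentication key pair. -/
structure RegVars where
  username : Name
  appid : Name
  aaid : Name
  challenge : Text
  authk : AKey

/-- The variables of authentication. -/
structure AuthVars where
  appid : Name
  challenge : Text
  authk : AKey
  n : Rand

/-- Regular strands: a role with values for its variables. -/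
inductive Inst where
  | clientReg (t : ClientTLS) (u : RegVars)
  | serverReg (t : ServerTLS) (u : RegVars)
  | clientAuth (t : ClientTLS) (u : AuthVars)
  | serverAuth (t : ServerTLS) (u : AuthVars)

def Inst.role : Inst → Role
  | .clientReg _ _ => .clientReg
  | .serverReg _ _ => .serverReg
  | .clientAuth _ _ => .clientAuth
  | .serverAuth _ _ => .serverAuth

def Inst.side : Inst → Side
  | .clientReg _ _ => .client
  | .serverReg _ _ => .server
  | .clientAuth _ _ => .client
  | .serverAuth _ _ => .server

noncomputable def ClientTLS.view (t : ClientTLS) : TLS :=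
  ⟨t.server, t.ca, t.spk, t.cr, t.sr, rx t.x, t.y⟩

noncomputable def ServerTLS.view (t : ServerTLS) : TLS :=
  ⟨t.server, t.ca, t.spk, t.cr, t.sr, t.x, rx t.y⟩

noncomputable def Inst.tls : Inst → TLS
  | .clientReg t _ => t.view
  | .serverReg t _ => t.view
  | .clientAuth t _ => t.view
  | .serverAuth t _ => t.view

/-- The atomic secret that the strand generates itself. -/
def Inst.ownSecret : Inst → Rndx
  | .clientReg t _ => t.x
  | .serverReg t _ => t.y
  | .clientAuth t _ => t.x
  | .serverAuth t _ => t.y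

def Inst.appid : Inst → Name
  | .clientReg _ u => u.appid
  | .serverReg _ u => u.appid
  | .clientAuth _ u => u.appid
  | .serverAuth _ u => u.appid

def Inst.challenge : Inst → Text
  | .clientReg _ u => u.challenge
  | .serverReg _ u => u.challenge
  | .clientAuth _ u => u.challenge
  | .serverAuth _ u => u.challenge

/-- The server's key pair (public half): the long-term key of its name in the TLS 1.2 models, a
variable of its own in the TLS 1.3 model. -/
def TLS.key (M : Model) (t : TLS) : AKey :=
  match M with
  | .exporterTLS13 => t.spk
  | _ => pubk t.server

/-- The certificate of the server, signed by the certificate authority. -/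
def TLS.certificate (M : Model) (t : TLS) : Msg :=
  .name t.server ⋄ .akey (t.key M) ⋄ .name t.ca ⋄
    .enc (.name t.server ⋄ .akey (t.key M) ⋄ .name t.ca) (.akey (privk t.ca))

/-- The shared Diffie-Hellman value `g ^ (x y)`. -/
noncomputable def TLS.shared (t : TLS) : Msg := .dh (t.x + t.y)

/-! TLS 1.2 with ephemeral Diffie-Hellman key exchange. -/

/-- The server's signature on its Diffie-Hellman value and the two randoms. -/
def TLS.keyExchangeSig (M : Model) (t : TLS) : Msg :=
  .enc (.rand t.cr ⋄ .rand t.sr ⋄ .dh t.y) (.akey (t.key M).inv)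

noncomputable def TLS.master12 (t : TLS) : Msg :=
  .hash (t.shared ⋄ .tag .masterSecret ⋄ .rand t.cr ⋄ .rand t.sr)

noncomputable def TLS.cwk12 (t : TLS) : Msg :=
  .hash (t.master12 ⋄ .tag .clientWrite ⋄ .rand t.cr ⋄ .rand t.sr)

noncomputable def TLS.swk12 (t : TLS) : Msg :=
  .hash (t.master12 ⋄ .tag .serverWrite ⋄ .rand t.cr ⋄ .rand t.sr)

/-- The handshake messages before the Finished messages. -/
def TLS.transcript12 (M : Model) (t : TLS) : Msg :=
  .rand t.cr ⋄ .rand t.sr ⋄ t.certificate M ⋄ .dh t.y ⋄ t.keyExchangeSig M ⋄ .dh t.x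

noncomputable def TLS.clientFinished12 (M : Model) (t : TLS) : Msg :=
  .enc (.hash (t.master12 ⋄ .tag .clientFinished ⋄ .hash (t.transcript12 M))) t.cwk12

noncomputable def TLS.serverFinished12 (M : Model) (t : TLS) : Msg :=
  .enc (.hash (t.master12 ⋄ .tag .serverFinished ⋄
    .hash (t.transcript12 M ⋄ t.clientFinished12 M))) t.swk12

/-- The TLS 1.2 handshake; each message goes with the end that transmits it. -/
noncomputable def TLS.handshake12 (M : Model) (t : TLS) : List (Side × Msg) :=
  [(.client, .rand t.cr),
   (.server, .rand t.sr ⋄ t.certificate M ⋄ .dh t.y ⋄ t.keyExchangeSig M),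
   (.client, .dh t.x ⋄ t.clientFinished12 M),
   (.server, t.serverFinished12 M)]

/-! TLS 1.3. -/

def TLS.clientHello (t : TLS) : Msg := .rand t.cr ⋄ .dh t.x

def TLS.serverHello (t : TLS) : Msg := .rand t.sr ⋄ .dh t.y

noncomputable def TLS.handshakeSecret (t : TLS) : Msg :=
  .hash (.tag .handshakeSecret ⋄ t.shared)

noncomputable def TLS.chk13 (t : TLS) : Msg :=
  .hash (t.handshakeSecret ⋄ .tag .clientHandshake ⋄ .hash (t.clientHello ⋄ t.serverHello))

noncomputable def TLS.shk13 (t : TLS) : Msg :=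
  .hash (t.handshakeSecret ⋄ .tag .serverHandshake ⋄ .hash (t.clientHello ⋄ t.serverHello))

def TLS.certificateVerify (M : Model) (t : TLS) : Msg :=
  .enc (.tag .certificateVerify ⋄ .hash (t.clientHello ⋄ t.serverHello ⋄ t.certificate M))
    (.akey (t.key M).inv)

noncomputable def TLS.serverFinished13 (M : Model) (t : TLS) : Msg :=
  .hash (t.shk13 ⋄ .tag .finished ⋄
    .hash (t.clientHello ⋄ t.serverHello ⋄ t.certificate M ⋄ t.certificateVerify M))

/-- The hash of the handshake messages up to the Finished message of the server. -/
noncomputable def TLS.transcript13 (M : Model) (t : TLS) : Msg :=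
  .hash (t.clientHello ⋄ t.serverHello ⋄ t.certificate M ⋄ t.certificateVerify M ⋄
    t.serverFinished13 M)

noncomputable def TLS.clientFinished13 (M : Model) (t : TLS) : Msg :=
  .hash (t.chk13 ⋄ .tag .finished ⋄ t.transcript13 M)

noncomputable def TLS.master13 (t : TLS) : Msg :=
  .hash (.tag .masterSecret ⋄ t.handshakeSecret)

noncomputable def TLS.cwk13 (M : Model) (t : TLS) : Msg :=
  .hash (t.master13 ⋄ .tag .clientWrite ⋄ t.transcript13 M)

noncomputable def TLS.swk13 (M : Model) (t : TLS) : Msg :=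
  .hash (t.master13 ⋄ .tag .serverWrite ⋄ t.transcript13 M)

/-- The TLS 1.3 handshake. -/
noncomputable def TLS.handshake13 (M : Model) (t : TLS) : List (Side × Msg) :=
  [(.client, t.clientHello),
   (.server, t.serverHello ⋄
      .enc (t.certificate M ⋄ t.certificateVerify M ⋄ t.serverFinished13 M) t.shk13),
   (.client, .enc (t.clientFinished13 M) t.chk13)]

/-! UAF over the TLS channel. -/

noncomputable def TLS.handshake (M : Model) (t : TLS) : List (Side × Msg) :=
  match M with
  | .exporterTLS13 => t.handshake13 M
  | _ => t.handshake12 M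

/-- The client write key. -/
noncomputable def TLS.cwk (M : Model) (t : TLS) : Msg :=
  match M with
  | .exporterTLS13 => t.cwk13 M
  | _ => t.cwk12

/-- The server write key. -/
noncomputable def TLS.swk (M : Model) (t : TLS) : Msg :=
  match M with
  | .exporterTLS13 => t.swk13 M
  | _ => t.swk12

/-- The channel binding. -/
noncomputable def tlsData (M : Model) (t : TLS) (challenge : Text) : Msg :=
  match M with
  | .endpointTLS12DH =>
      .hash (.tag .uafServerEndpoint ⋄ .text challenge ⋄ .hash (t.certificate M))
  | .serverCertTLS12DH =>
      .hash (.tag .uafServerCert ⋄ .text challenge ⋄ t.certificate M)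
  | .exporterTLS13 =>
      .hash (t.master13 ⋄ .tag .exporterChannelBinding ⋄ .rand t.cr ⋄ .rand t.sr ⋄
        .akey (t.key M))

/-- The final challenge. -/
noncomputable def finalChallenge (M : Model) (t : TLS) (appid : Name) (challenge : Text) : Msg :=
  .hash (.name appid ⋄ .text challenge ⋄ tlsData M t challenge)

noncomputable def regMessages (M : Model) (t : TLS) (u : RegVars) : List (Side × Msg) :=
  let fc := finalChallenge M t u.appid u.challenge
  [(.server, .enc (.name u.username ⋄ .name u.appid ⋄ .text u.challenge) (t.swk M)),
   (.client, .enc (.hash (.akey u.authk.inv ⋄ .name u.username) ⋄ .name u.aaid ⋄ .akey u.authk ⋄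
      fc ⋄ .enc (.name u.aaid ⋄ fc ⋄ .akey u.authk) (.akey (privk u.aaid))) (t.cwk M))]

noncomputable def authMessages (M : Model) (t : TLS) (u : AuthVars) : List (Side × Msg) :=
  let fc := finalChallenge M t u.appid u.challenge
  [(.server, .enc (.name u.appid ⋄ .text u.challenge) (t.swk M)),
   (.client, .enc (fc ⋄ .rand u.n ⋄ .enc (fc ⋄ .rand u.n) (.akey u.authk.inv)) (t.cwk M))]

noncomputable def Inst.messages (M : Model) : Inst → List (Side × Msg)
  | .clientReg t u => t.view.handshake M ++ regMessages M t.view u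
  | .serverReg t u => t.view.handshake M ++ regMessages M t.view u
  | .clientAuth t u => t.view.handshake M ++ authMessages M t.view u
  | .serverAuth t u => t.view.handshake M ++ authMessages M t.view u

/-- The event of a message at one end, given the end that transmits it. -/
def eventAt : Side → Side × Msg → Event
  | .client, (.client, m) => .send m
  | .client, (.server, m) => .recv m
  | .server, (.client, m) => .recv m
  | .server, (.server, m) => .send m

noncomputable def Inst.trace (M : Model) (s : Inst) : List Event :=
  (s.messages M).map (eventAt s.side)

/-- The height of the roles of a model. -/
def fullHeight : Model → ℕ
  | .exporterTLS13 => 5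
  | _ => 6

theorem Inst.length_trace (M : Model) (s : Inst) : (s.trace M).length = fullHeight M := by
  cases M <;> cases s <;> rfl

/-- The strand space of UAF registration and authentication over TLS.  Every role declares its own
Diffie-Hellman secret to be uniquely generated. -/
noncomputable def uaf (M : Model) : Protocol where
  Role := Role
  Inst := Inst
  role := Inst.role
  trace := Inst.trace M
  height := fun _ => fullHeight M
  length_trace := Inst.length_trace M
  uniqGen := fun s => {s.ownSecret}
  compl := Role.Compl

/-- Agreement on the TLS session context. -/
def TLSContext (t t' : TLS) : Prop :=
  t.server = t'.server ∧ t.ca = t'.ca ∧ t.cr = t'.cr ∧ t.sr = t'.sr ∧ t.x = t'.x ∧ t.y = t'.y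

/-- The session context of UAF authentication. -/
def authContext (M : Model) : Context (uaf M) := fun (s s' : Inst) =>
  TLSContext s.tls s'.tls ∧ s.challenge = s'.challenge ∧ s.tls.server = s'.tls.server ∧
    s.appid = s'.appid

/-- The server assumptions for an authentication server strand: the private keys of the certificate
authority, of the server and of the authenticator are non-originating; the server random and the
challenge originate uniquely on the strand, and its Diffie-Hellman secret is generated uniquely
there. -/
def serverAssumptions (M : Model) : Assumptions (uaf M) := fun B k (s : Inst) =>
  ∃ t u, s = .serverAuth t u ∧
    B.NonOrig (.akey (privk t.ca)) ∧
    B.NonOrig (.akey (t.view.key M).inv) ∧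
    B.NonOrig (.akey u.authk.inv) ∧
    B.UniqOrigOn (.rand t.sr) k ∧
    B.UniqGenOn t.y k ∧
    B.UniqOrigOn (.text u.challenge) k

end UAF

namespace UAF

/-! ### Carried messages -/

/-! Everything rests on one principle: a finite acyclic bundle has a minimal node among those whose
message carries an element of a set `S`, and that node is a transmission. If it lies on a penetrator
strand, the penetrator has built an element of `S` from messages that carry none
(`Bundle.exists_source`). Hence a term under a non-originating key comes from a regular strand
(`NonOrig.exists_regular`), a hash of a secret that no regular strand sends is itself secret
(`NonOrig.hash`), and a DH value depending on the fresh secrets of two regular strands is secret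
(`nonOrig_dh`). What regular strands send is a finite check, since the shapes of the signed and
encrypted bodies tell the messages apart.

The last message that the server receives contains a signature on the final challenge under the
authenticator's key. It comes from a client at its last step, and injectivity of hashing gives equal
`appid`, `challenge` and `tlsData`.

In TLS 1.3 `tlsData` already fixes both randoms and the server key. The handshake signature accepted
by the client then comes from a server with these randoms, which is the given one because `sr` is
unique, and its transcript fixes the rest (`tlsContext_of_exporter`).

In TLS 1.2 `tlsData` fixes only the certificate. The signature on the client's `cr`, `sr`, `g ^ y`
shows that `y` belongs to some regular server, so `g ^ (x y)`, the master secret and the server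
write key are secret. The encrypted challenge therefore comes from an authentication server, and
uniqueness of the challenge makes it the given one. Equal write keys give equal randoms and an equal
shared secret; uniqueness of `sr` then identifies the signing server too, and `x` follows by
cancelling `y` (`tlsContext_of_ne_exporter`).

Injectivity holds because a strand that agrees on the context has `x` or `y` as its own uniquely
generated secret. Uniqueness of the role needs a bundle in which the assumptions hold, since
otherwise `Succ` would be vacuous; the honest session provides it. -/

theorem Carried.trans {a b c : Msg} (h : Carried a b) (h' : Carried b c) : Carried a c := by
  induction h' with
  | refl => exact h
  | left _ ih => exact ih.left
  | right _ ih => exact ih.right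
  | body _ ih => exact ih.body

@[simp] theorem carried_name {t : Msg} {a : Name} : Carried t (.name a) ↔ t = .name a :=
  ⟨fun h => by cases h; rfl, fun h => h ▸ .refl⟩

@[simp] theorem carried_text {t : Msg} {a : Text} : Carried t (.text a) ↔ t = .text a :=
  ⟨fun h => by cases h; rfl, fun h => h ▸ .refl⟩

@[simp] theorem carried_rand {t : Msg} {a : Rand} : Carried t (.rand a) ↔ t = .rand a :=
  ⟨fun h => by cases h; rfl, fun h => h ▸ .refl⟩

@[simp] theorem carried_tag {t : Msg} {a : Tag} : Carried t (.tag a) ↔ t = .tag a :=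
  ⟨fun h => by cases h; rfl, fun h => h ▸ .refl⟩

@[simp] theorem carried_akey {t : Msg} {a : AKey} : Carried t (.akey a) ↔ t = .akey a :=
  ⟨fun h => by cases h; rfl, fun h => h ▸ .refl⟩

@[simp] theorem carried_expt {t : Msg} {e : Expt} : Carried t (.expt e) ↔ t = .expt e :=
  ⟨fun h => by cases h; rfl, fun h => h ▸ .refl⟩

@[simp] theorem carried_dh {t : Msg} {e : Expt} : Carried t (.dh e) ↔ t = .dh e :=
  ⟨fun h => by cases h; rfl, fun h => h ▸ .refl⟩

@[simp] theorem carried_hash {t m : Msg} : Carried t (.hash m) ↔ t = .hash m :=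
  ⟨fun h => by cases h; rfl, fun h => h ▸ .refl⟩

@[simp] theorem carried_pair {t a b : Msg} :
    Carried t (a ⋄ b) ↔ t = a ⋄ b ∨ Carried t a ∨ Carried t b := by
  constructor
  · intro h
    cases h with
    | refl => exact .inl rfl
    | left h => exact .inr (.inl h)
    | right h => exact .inr (.inr h)
  · rintro (rfl | h | h)
    exacts [.refl, .left h, .right h]

@[simp] theorem carried_enc {t m k : Msg} :
    Carried t (.enc m k) ↔ t = .enc m k ∨ Carried t m := by
  constructor
  · intro h
    cases h with
    | refl => exact .inl rfl
    | body h => exact .inr h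
  · rintro (rfl | h)
    exacts [.refl, .body h]

/-- `m` carries a message of the set `S`. -/
def Carries (S : Set Msg) (m : Msg) : Prop := ∃ t ∈ S, Carried t m

theorem Carries.mono {S : Set Msg} {a b : Msg} (h : Carries S a) (hab : Carried a b) :
    Carries S b :=
  let ⟨t, ht, hc⟩ := h
  ⟨t, ht, hc.trans hab⟩

theorem carries_singleton {t m : Msg} : Carries {t} m ↔ Carried t m := by
  simp [Carries]

/-! ### First transmissions -/

namespace Bundle

variable {P : Protocol} (B : Bundle P)

/-- The strand of `n` transmits a message with property `Q` at `n`, and no earlier message of the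
strand has it. -/
def FirstSend (Q : Msg → Prop) (n : B.Node) : Prop :=
  (∃ m, B.event n = some (.send m) ∧ Q m) ∧
    ∀ i < n.2, ∀ e, B.event (n.1, i) = some e → ¬ Q e.msg

variable {B}

theorem event_eq_some {n : B.Node} {e : Event} :
    B.event n = some e ↔ n.2 < B.height n.1 ∧ (B.strand n.1).trace[n.2]? = some e := by
  unfold event
  split_ifs with h <;> simp [h]

theorem event_of_le {n : B.Node} {e : Event} (h : B.event n = some e) {i : ℕ} (hi : i ≤ n.2) :
    B.event (n.1, i) = (B.strand n.1).trace[i]? := by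
  have := (event_eq_some.1 h).1
  exact if_pos (lt_of_le_of_lt hi this)

variable (B) in
/-- The causal order. -/
def Precedes : B.Node → B.Node → Prop :=
  Relation.TransGen
    (fun a b => B.comm a b ∨ (a.1 = b.1 ∧ a.2 + 1 = b.2 ∧ b.2 < B.height b.1))

theorem precedes_of_lt (k : Fin B.size) {i j : ℕ} (hij : i < j) (hj : j < B.height k) :
    B.Precedes (k, i) (k, j) := by
  induction j, hij using Nat.le_induction with
  | base => exact .single (.inr ⟨rfl, rfl, hj⟩)
  | succ j _ ih => exact (ih (by omega)).tail (.inr ⟨rfl, rfl, hj⟩)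

/-- If a message of the bundle has property `Q`, then some strand transmits such a message before
any other message with that property. -/
theorem exists_firstSend {Q : Msg → Prop} {n : B.Node} {e : Event} (h : B.event n = some e)
    (hQ : Q e.msg) : ∃ n, B.FirstSend Q n := by
  let N := {n : B.Node // n.2 < B.height n.1}
  have : Finite N := by
    let f : N → Σ k : Fin B.size, Fin (B.height k) := fun n => ⟨n.1.1, n.1.2, n.2⟩
    refine Finite.of_injective f ?_
    rintro ⟨⟨k, i⟩, hi⟩ ⟨⟨l, j⟩, hj⟩ hf
    simp only [f, Sigma.mk.injEq] at hf
    obtain ⟨rfl, hf⟩ := hf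
    obtain rfl : i = j := by simpa using hf
    rfl
  let r : N → N → Prop := fun a b => B.Precedes a.1 b.1
  have : IsTrans N r := ⟨fun _ _ _ => Relation.TransGen.trans⟩
  have : Std.Irrefl r := ⟨fun a => B.acyclic a.1⟩
  have wf : WellFounded r := Finite.wellFounded_of_trans_of_irrefl r
  obtain ⟨⟨n₀, hn₀⟩, ⟨e₀, he₀, hQ₀⟩, hmin⟩ := wf.has_min
    {n : N | ∃ e, B.event n.1 = some e ∧ Q e.msg} ⟨⟨n, (event_eq_some.1 h).1⟩, e, h, hQ⟩
  refine ⟨n₀, ?_, fun i hi e' he' hQ' => ?_⟩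
  · cases e₀ with
    | send m => exact ⟨m, he₀, hQ₀⟩
    | recv m =>
      -- A reception cannot be minimal: the transmission matched with it has the same message and
      -- comes earlier.
      obtain ⟨a, ha, -⟩ := B.recv_unique n₀ m hn₀ (event_eq_some.1 he₀).2
      obtain ⟨ha₁, -, -, m', hs, hr⟩ := B.comm_spec _ _ ha
      obtain rfl : m' = m := by
        have := hr.symm.trans (event_eq_some.1 he₀).2
        simpa using this
      exact absurd (Relation.TransGen.single (.inl ha))
        (hmin ⟨a, ha₁⟩ ⟨_, event_eq_some.2 ⟨ha₁, hs⟩, hQ₀⟩)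
  · have hi' : i < B.height n₀.1 := hi.trans hn₀
    exact hmin ⟨(n₀.1, i), hi'⟩ ⟨e', he', hQ'⟩ (precedes_of_lt n₀.1 hi hn₀)

/-- `FirstSend (Carried t)` unfolds to origination of `t`, just as `FirstSend (Occurs r)` unfolds to
generation of `r`; so minimal nodes can be fed directly to the freshness assumptions. -/
theorem UniqOrigOn.eq {t : Msg} {k l : Fin B.size} {i : ℕ} (h : B.UniqOrigOn t k)
    (h' : B.FirstSend (Carried t) (l, i)) : l = k := by
  obtain ⟨j, -, hj⟩ := h
  exact congrArg Prod.fst (hj _ h')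

theorem UniqGenOn.eq {r : Rndx} {k l : Fin B.size} {i : ℕ} (h : B.UniqGenOn r k)
    (h' : B.FirstSend (Occurs r) (l, i)) : l = k := by
  obtain ⟨j, -, hj⟩ := h
  exact congrArg Prod.fst (hj _ h')

theorem UniqGenOn.unique {r : Rndx} {k l : Fin B.size} (h : B.UniqGenOn r k)
    (h' : B.UniqGenOn r l) : l = k := by
  obtain ⟨j, hj, -⟩ := h'
  exact h.eq hj

end Bundle

/-! ### The penetrator -/

/-- A penetrator strand that puts the message `m` together from the messages it receives. -/
inductive Pen.Builds : Pen → List Msg → Msg → Prop where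
  | name (a : Name) : Builds (.name a) [] (.name a)
  | text (t : Text) : Builds (.text t) [] (.text t)
  | rand (r : Rand) : Builds (.rand r) [] (.rand r)
  | tag (c : Tag) : Builds (.tag c) [] (.tag c)
  | key (k : AKey) : Builds (.key k) [] (.akey k)
  | gen : Builds .gen [] (.dh 0)
  | rndx (r : Rndx) : Builds (.rndx r) [] (.expt (rx r))
  | mulExpt (e f : Expt) : Builds (.mulExpt e f) [.expt e, .expt f] (.expt (e + f))
  | invExpt (e : Expt) : Builds (.invExpt e) [.expt e] (.expt (-e))
  | exp (e f : Expt) : Builds (.exp e f) [.dh e, .expt f] (.dh (e + f))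
  | concat (m₁ m₂ : Msg) : Builds (.concat m₁ m₂) [m₁, m₂] (m₁ ⋄ m₂)
  | encrypt (m k : Msg) : Builds (.encrypt m k) [m, k] (.enc m k)
  | hash (m : Msg) : Builds (.hash m) [m] (.hash m)

/-- If the penetrator is the first on a strand to transmit a message that carries an element of `S`,
then it builds an element of `S` from messages that carry none. -/
theorem Pen.builds_of_firstSend {S : Set Msg} {p : Pen} {i : ℕ} {m : Msg}
    (h : p.trace[i]? = some (.send m)) (hm : Carries S m)
    (hlt : ∀ j < i, ∀ e, p.trace[j]? = some e → ¬ Carries S e.msg) :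
    ∃ l, p.Builds l m ∧ m ∈ S ∧ ∀ a ∈ l, ¬ Carries S a := by
  -- Penetrator strands have at most three events, so only positions 0 and 1 can precede a
  -- transmission.
  have h0 : ∀ e, 0 < i → p.trace[0]? = some e → ¬ Carries S e.msg := fun e hi => hlt 0 hi e
  have h1 : ∀ e, 1 < i → p.trace[1]? = some e → ¬ Carries S e.msg := fun e hi => hlt 1 hi e
  rcases i with _ | _ | _ | i <;> cases p <;> simp [Pen.trace] at h h0 h1
  all_goals subst h
  all_goals try simp only [Event.msg] at h0 h1
  -- Duplicating, projecting and decrypting only pass on content that an earlier reception already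
  -- carried. The strands left over are those that build.
  all_goals first
    | exact absurd hm h0
    | exact absurd (hm.mono (.left .refl)) h0
    | exact absurd (hm.mono (.right .refl)) h0
    | exact absurd (hm.mono (.body .refl)) h0
    | skip
  all_goals
    obtain ⟨t, htS, ht⟩ := hm
    cases ht
  all_goals first
    | exact absurd ⟨_, htS, by assumption⟩ h0
    | exact absurd ⟨_, htS, by assumption⟩ h1
    | refine ⟨_, by constructor, htS, ?_⟩
  all_goals simp only [List.mem_cons, List.not_mem_nil, or_false, forall_eq_or_imp, forall_eq,
    false_imp_iff, implies_true]
  all_goals first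
    | exact h0
    | exact ⟨h0, h1⟩

/-- This turns the abstract ingredients of `Pen.Builds` into messages of the bundle, to which
secrecy assumptions apply. -/
theorem Pen.Builds.exists_recv {p : Pen} {l : List Msg} {m : Msg} (h : p.Builds l m) {i : ℕ}
    (hi : p.trace[i]? = some (.send m)) :
    ∀ a ∈ l, ∃ j < i, p.trace[j]? = some (.recv a) := by
  cases h <;> rcases i with _ | _ | _ | i <;> simp [Pen.trace] at hi
  all_goals
    simp only [List.mem_cons, List.not_mem_nil, or_false, forall_eq_or_imp, forall_eq,
      false_imp_iff, implies_true]
  all_goals first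
    | exact ⟨0, by omega, rfl⟩
    | exact ⟨⟨0, by omega, rfl⟩, ⟨1, by omega, rfl⟩⟩

/-! ### Sources of carried messages -/

namespace Bundle

variable {P : Protocol} {B : Bundle P}

/-- A message that carries an element of `S` is first transmitted either by a regular strand or by
a penetrator strand that builds an element of `S` from messages it receives that carry none. -/
theorem exists_source {S : Set Msg} {n : B.Node} {e : Event} (h : B.event n = some e)
    (hS : Carries S e.msg) :
    (∃ k i s m, B.strand k = .regular s ∧ B.event (k, i) = some (.send m) ∧
      (P.trace s)[i]? = some (.send m) ∧ Carries S m) ∨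
    ∃ k i p l m, B.strand k = .penetrator p ∧ B.event (k, i) = some (.send m) ∧
      p.trace[i]? = some (.send m) ∧ p.Builds l m ∧ m ∈ S ∧
      ∀ a ∈ l, ¬ Carries S a ∧ ∃ j, B.event (k, j) = some (.recv a) := by
  obtain ⟨⟨k, i⟩, ⟨m, hm, hSm⟩, hlt⟩ := exists_firstSend h hS
  have hm' := (event_eq_some.1 hm).2
  rcases hk : B.strand k with s | p
  · simp only [hk, Strand.trace] at hm'
    exact .inl ⟨k, i, s, m, hk, hm, hm', hSm⟩
  · simp only [hk, Strand.trace] at hm'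
    obtain ⟨l, hl, hmS, hla⟩ := Pen.builds_of_firstSend hm' hSm fun j hj e he => by
      refine hlt j hj e ?_
      rw [event_of_le hm (le_of_lt hj)]
      simpa only [hk, Strand.trace] using he
    refine .inr ⟨k, i, p, l, m, hk, hm, hm', hl, hmS, fun a ha => ⟨hla a ha, ?_⟩⟩
    obtain ⟨j, hj, hja⟩ := hl.exists_recv hm' a ha
    refine ⟨j, ?_⟩
    rw [event_of_le hm (le_of_lt hj)]
    simpa only [hk, Strand.trace] using hja

end Bundle
/-! ### Regular strands -/

theorem rx_injective {r r' : Rndx} (h : rx r = rx r') : r = r' :=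
  (Finsupp.single_left_inj one_ne_zero).1 h

@[simp] theorem rx_apply_ne_zero {r r' : Rndx} : rx r r' ≠ 0 ↔ r = r' := by
  simp [rx, Finsupp.single_apply]

theorem Inst.lt_fullHeight {M : Model} {s : Inst} {i : ℕ} {e : Event}
    (h : (s.trace M)[i]? = some e) : i < fullHeight M := by
  have := (List.getElem?_eq_some_iff.1 h).1
  rwa [Inst.length_trace] at this

theorem fullHeight_le (M : Model) : fullHeight M ≤ 6 := by
  cases M <;> simp [fullHeight]

theorem Inst.messages_of_send {M : Model} {s : Inst} {i : ℕ} {m : Msg}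
    (h : (s.trace M)[i]? = some (.send m)) :
    (s.messages M)[i]? = some (s.side, m) := by
  simp only [Inst.trace, List.getElem?_map, Option.map_eq_some_iff] at h
  obtain ⟨⟨d, m'⟩, h, h'⟩ := h
  rw [h]
  cases hs : s.side <;> cases d <;> simp_all [eventAt]

/-- The only strands that put a final challenge and a nonce under an asymmetric key are the clients
of authentication, at the very end. -/
theorem Inst.eq_clientAuth_of_carried {M : Model} {s : Inst} {i : ℕ} {m : Msg} {b : Msg} {r : Rand} {k : AKey}
    (h : (s.trace M)[i]? = some (.send m))
    (hc : Carried (.enc (.hash b ⋄ .rand r) (.akey k)) m) :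
    ∃ t u, s = .clientAuth t u ∧ fullHeight M = i + 1 ∧
      finalChallenge M t.view u.appid u.challenge = .hash b := by
  have hi := (Inst.lt_fullHeight h).trans_le (fullHeight_le M)
  replace h := Inst.messages_of_send h
  -- A finite check over positions, models and roles. A body starting with a hash and ending in a
  -- random under an asymmetric key matches no certificate, handshake or registration signature.
  rcases i with _ | _ | _ | _ | _ | _ | i
  any_goals omega
  all_goals
    cases M <;> cases s <;> simp [Inst.messages, TLS.handshake, TLS.handshake12, TLS.handshake13,
      regMessages, authMessages, Inst.side] at h
  all_goals
    subst h
    simp [TLS.clientHello, TLS.serverHello, TLS.certificate, TLS.keyExchangeSig,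
      TLS.clientFinished12, TLS.clientFinished13, TLS.serverFinished12, TLS.serverFinished13,
      TLS.certificateVerify, finalChallenge, TLS.chk13, TLS.shk13, TLS.cwk12, TLS.swk12,
      fullHeight] at hc ⊢
  all_goals exact hc.1.1.symm

/-- Only servers sign two randoms and a Diffie-Hellman value. -/
theorem Inst.keyExchangeSig_of_carried {M : Model} {s : Inst} {i : ℕ} {m : Msg} {cr sr : Rand} {y : Expt} {k : AKey}
    (h : (s.trace M)[i]? = some (.send m))
    (hc : Carried (.enc (.rand cr ⋄ .rand sr ⋄ .dh y) (.akey k)) m) :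
    s.side = .server ∧ i = 1 ∧ s.tls.cr = cr ∧ s.tls.sr = sr ∧ s.tls.y = y ∧
      (s.tls.key M).inv = k := by
  have hi := (Inst.lt_fullHeight h).trans_le (fullHeight_le M)
  replace h := Inst.messages_of_send h
  rcases i with _ | _ | _ | _ | _ | _ | i
  any_goals omega
  all_goals
    cases M <;> cases s <;> simp [Inst.messages, TLS.handshake, TLS.handshake12, TLS.handshake13,
      regMessages, authMessages, Inst.side] at h
  all_goals
    subst h
    simp [TLS.clientHello, TLS.serverHello, TLS.certificate, TLS.keyExchangeSig,
      TLS.clientFinished12, TLS.clientFinished13, TLS.serverFinished12, TLS.serverFinished13,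
      TLS.certificateVerify, finalChallenge, TLS.chk13, TLS.shk13, TLS.cwk12, TLS.swk12,
      Inst.tls] at hc ⊢
  all_goals exact ⟨rfl, hc.1.1.symm, hc.1.2.1.symm, hc.1.2.2.symm, hc.2.symm⟩

/-- Only servers sign a handshake transcript. -/
theorem Inst.certificateVerify_of_carried {M : Model} {s : Inst} {i : ℕ} {m : Msg} {b : Msg} {k : AKey}
    (h : (s.trace M)[i]? = some (.send m))
    (hc : Carried (.enc (.tag .certificateVerify ⋄ .hash b) (.akey k)) m) :
    s.side = .server ∧ i = 1 ∧
      s.tls.clientHello ⋄ s.tls.serverHello ⋄ s.tls.certificate M = b := by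
  have hi := (Inst.lt_fullHeight h).trans_le (fullHeight_le M)
  replace h := Inst.messages_of_send h
  rcases i with _ | _ | _ | _ | _ | _ | i
  any_goals omega
  all_goals
    cases M <;> cases s <;> simp [Inst.messages, TLS.handshake, TLS.handshake12, TLS.handshake13,
      regMessages, authMessages, Inst.side] at h
  all_goals
    subst h
    simp [TLS.clientHello, TLS.serverHello, TLS.certificate, TLS.keyExchangeSig,
      TLS.clientFinished12, TLS.clientFinished13, TLS.serverFinished12, TLS.serverFinished13,
      TLS.certificateVerify, finalChallenge, TLS.chk13, TLS.shk13, TLS.cwk12, TLS.swk12,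
      Inst.tls] at hc ⊢
  all_goals exact ⟨rfl, hc.1.symm⟩

/-- The challenge message of authentication is sent by the servers of authentication only. -/
theorem Inst.eq_serverAuth_of_carried {M : Model} {s : Inst} {i : ℕ} {m : Msg} {a : Name} {c : Text} {k : Msg}
    (h : (s.trace M)[i]? = some (.send m))
    (hc : Carried (.enc (.name a ⋄ .text c) k) m) :
    ∃ t u, s = .serverAuth t u ∧ i + 2 = fullHeight M ∧ u.appid = a ∧ u.challenge = c ∧
      t.view.swk M = k := by
  have hi := (Inst.lt_fullHeight h).trans_le (fullHeight_le M)
  replace h := Inst.messages_of_send h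
  rcases i with _ | _ | _ | _ | _ | _ | i
  any_goals omega
  all_goals
    cases M <;> cases s <;> simp [Inst.messages, TLS.handshake, TLS.handshake12, TLS.handshake13,
      regMessages, authMessages, Inst.side] at h
  all_goals
    subst h
    simp [TLS.clientHello, TLS.serverHello, TLS.certificate, TLS.keyExchangeSig,
      TLS.clientFinished12, TLS.clientFinished13, TLS.serverFinished12, TLS.serverFinished13,
      TLS.certificateVerify, finalChallenge, TLS.chk13, TLS.shk13, TLS.cwk12, TLS.swk12,
      fullHeight] at hc ⊢
  all_goals exact ⟨hc.1.1.symm, hc.1.2.symm, hc.2.symm⟩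

/-- The only Diffie-Hellman value that a regular strand sends in the clear is its own. -/
theorem Inst.eq_of_carried_dh {M : Model} {s : Inst} {i : ℕ} {m : Msg} {e : Expt}
    (h : (s.trace M)[i]? = some (.send m))
    (hc : Carried (.dh e) m) :
    e = rx s.ownSecret := by
  have hi := (Inst.lt_fullHeight h).trans_le (fullHeight_le M)
  replace h := Inst.messages_of_send h
  rcases i with _ | _ | _ | _ | _ | _ | i
  any_goals omega
  all_goals
    cases M <;> cases s <;> simp [Inst.messages, TLS.handshake, TLS.handshake12, TLS.handshake13,
      regMessages, authMessages, Inst.side] at h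
  all_goals
    subst h
    simp [TLS.clientHello, TLS.serverHello, TLS.certificate, TLS.keyExchangeSig,
      TLS.clientFinished12, TLS.clientFinished13, TLS.serverFinished12, TLS.serverFinished13,
      TLS.certificateVerify, finalChallenge, TLS.chk13, TLS.shk13, TLS.cwk12, TLS.swk12,
      ClientTLS.view, ServerTLS.view, Inst.ownSecret] at hc ⊢
  all_goals exact hc

/-- Regular strands send no exponents. -/
theorem Inst.not_carried_expt {M : Model} {s : Inst} {i : ℕ} {m : Msg} {e : Expt}
    (h : (s.trace M)[i]? = some (.send m))
    (hc : Carried (.expt e) m) :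
    False := by
  have hi := (Inst.lt_fullHeight h).trans_le (fullHeight_le M)
  replace h := Inst.messages_of_send h
  rcases i with _ | _ | _ | _ | _ | _ | i
  any_goals omega
  all_goals
    cases M <;> cases s <;> simp [Inst.messages, TLS.handshake, TLS.handshake12, TLS.handshake13,
      regMessages, authMessages, Inst.side] at h
  all_goals
    subst h
    simp [TLS.clientHello, TLS.serverHello, TLS.certificate, TLS.keyExchangeSig,
      TLS.clientFinished12, TLS.clientFinished13, TLS.serverFinished12, TLS.serverFinished13,
      TLS.certificateVerify, finalChallenge, TLS.chk13, TLS.shk13, TLS.cwk12, TLS.swk12] at hc ⊢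

/-- Regular strands do not send TLS 1.2 master secrets. -/
theorem Inst.not_carried_master12 {M : Model} {s : Inst} {i : ℕ} {m : Msg} {t : TLS}
    (h : (s.trace M)[i]? = some (.send m))
    (hc : Carried t.master12 m) :
    False := by
  have hi := (Inst.lt_fullHeight h).trans_le (fullHeight_le M)
  replace h := Inst.messages_of_send h
  rcases i with _ | _ | _ | _ | _ | _ | i
  any_goals omega
  all_goals
    cases M <;> cases s <;> simp [Inst.messages, TLS.handshake, TLS.handshake12, TLS.handshake13,
      regMessages, authMessages, Inst.side] at h
  all_goals
    subst h
    simp [TLS.clientHello, TLS.serverHello, TLS.certificate, TLS.keyExchangeSig,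
      TLS.clientFinished12, TLS.clientFinished13, TLS.serverFinished12, TLS.serverFinished13,
      TLS.certificateVerify, finalChallenge, TLS.chk13, TLS.shk13, TLS.cwk12, TLS.swk12,
      TLS.master12, TLS.shared] at hc ⊢

/-- Regular strands do not send TLS 1.2 write keys. -/
theorem Inst.not_carried_swk12 {M : Model} {s : Inst} {i : ℕ} {m : Msg} {t : TLS}
    (h : (s.trace M)[i]? = some (.send m))
    (hc : Carried t.swk12 m) :
    False := by
  have hi := (Inst.lt_fullHeight h).trans_le (fullHeight_le M)
  replace h := Inst.messages_of_send h
  rcases i with _ | _ | _ | _ | _ | _ | i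
  any_goals omega
  all_goals
    cases M <;> cases s <;> simp [Inst.messages, TLS.handshake, TLS.handshake12, TLS.handshake13,
      regMessages, authMessages, Inst.side] at h
  all_goals
    subst h
    simp [TLS.clientHello, TLS.serverHello, TLS.certificate, TLS.keyExchangeSig,
      TLS.clientFinished12, TLS.clientFinished13, TLS.serverFinished12, TLS.serverFinished13,
      TLS.certificateVerify, finalChallenge, TLS.chk13, TLS.shk13, TLS.cwk12, TLS.swk12,
      TLS.master12, TLS.shared] at hc ⊢

theorem Inst.eq_cr_of_carried {M : Model} {s : Inst} {e : Event} {r : Rand}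
    (h : (s.trace M)[0]? = some e) (hc : Carried (.rand r) e.msg) : r = s.tls.cr := by
  cases M <;> cases s <;> simp [Inst.trace, Inst.messages, TLS.handshake, TLS.handshake12,
    TLS.handshake13, TLS.clientHello, Inst.side, eventAt] at h <;> subst h <;>
    simpa [Event.msg, Inst.tls] using hc

theorem Inst.exists_trace_zero_of_server {M : Model} {s : Inst} (hs : s.side = .server) :
    ∃ m, (s.trace M)[0]? = some (.recv m) ∧ Carried (.rand s.tls.cr) m := by
  cases M <;> cases s <;> simp [Inst.side] at hs
  · exact ⟨_, rfl, .refl⟩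
  · exact ⟨_, rfl, .refl⟩
  · exact ⟨_, rfl, .refl⟩
  · exact ⟨_, rfl, .refl⟩
  · exact ⟨_, rfl, .left .refl⟩
  · exact ⟨_, rfl, .left .refl⟩

theorem Inst.carried_sr {M : Model} {s : Inst} (hs : s.side = .server) {m : Msg}
    (h : (s.trace M)[1]? = some (.send m)) : Carried (.rand s.tls.sr) m := by
  replace h := Inst.messages_of_send h
  cases M <;> cases s <;> simp [Inst.side] at hs <;>
    simp [Inst.messages, TLS.handshake, TLS.handshake12, TLS.handshake13, TLS.serverHello,
      Inst.side] at h <;> subst h <;> simp [Inst.tls]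

/-- Handshake messages contain texts neither in the clear nor under encryption, so the challenge
originates at the challenge message, the last but one. -/
theorem Inst.not_carried_text {M : Model} {t : ServerTLS} {u : AuthVars} {i : ℕ} {e : Event}
    {c : Text} (h : ((Inst.serverAuth t u).trace M)[i]? = some e) (hi : i + 2 < fullHeight M) :
    ¬ Carried (.text c) e.msg := by
  have hi' := fullHeight_le M
  rcases i with _ | _ | _ | _ | i
  any_goals omega
  all_goals
    cases M <;> simp [fullHeight] at hi <;>
    simp [Inst.trace, Inst.messages, TLS.handshake, TLS.handshake12, TLS.handshake13, Inst.side,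
      eventAt] at h <;> subst h <;>
    simp [Event.msg, TLS.clientHello, TLS.serverHello, TLS.certificate, TLS.keyExchangeSig,
      TLS.clientFinished12, TLS.clientFinished13, TLS.serverFinished12, TLS.serverFinished13,
      TLS.certificateVerify]

theorem Inst.trace_serverAuth_last (M : Model) (t : ServerTLS) (u : AuthVars) :
    ((Inst.serverAuth t u).trace M)[fullHeight M - 1]? =
      some (.recv (.enc (finalChallenge M t.view u.appid u.challenge ⋄ .rand u.n ⋄
        .enc (finalChallenge M t.view u.appid u.challenge ⋄ .rand u.n) (.akey u.authk.inv))
          (t.view.cwk M))) := by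
  cases M <;> rfl

theorem Inst.trace_clientAuth_challenge (M : Model) (t : ClientTLS) (u : AuthVars) :
    ((Inst.clientAuth t u).trace M)[fullHeight M - 2]? =
      some (.recv (.enc (.name u.appid ⋄ .text u.challenge) (t.view.swk M))) := by
  cases M <;> rfl

theorem Inst.exists_trace_clientAuth_one_of_ne {M : Model} (hM : M ≠ .exporterTLS13) (t : ClientTLS)
    (u : AuthVars) : ∃ m, ((Inst.clientAuth t u).trace M)[1]? = some (.recv m) ∧
      Carried (t.view.keyExchangeSig M) m := by
  cases M
  · exact ⟨_, rfl, .right (.right (.right .refl))⟩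
  · exact ⟨_, rfl, .right (.right (.right .refl))⟩
  · contradiction

theorem Inst.exists_trace_clientAuth_one_exporter (t : ClientTLS) (u : AuthVars) :
    ∃ m, ((Inst.clientAuth t u).trace .exporterTLS13)[1]? = some (.recv m) ∧
      Carried (t.view.certificateVerify .exporterTLS13) m :=
  ⟨_, rfl, .right (.body (.right (.left .refl)))⟩

theorem Inst.tls_y_of_server {s : Inst} (hs : s.side = .server) : s.tls.y = rx s.ownSecret := by
  cases s <;> simp [Inst.side] at hs <;> rfl

theorem Inst.tls_x_of_client {s : Inst} (hs : s.side = .client) : s.tls.x = rx s.ownSecret := by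
  cases s <;> simp [Inst.side] at hs <;> rfl

theorem Inst.exists_occurs_ownSecret (M : Model) (s : Inst) :
    ∃ (i : ℕ) (e : Event), (s.trace M)[i]? = some e ∧ Occurs s.ownSecret e.msg := by
  cases s with
  | clientReg t u | clientAuth t u =>
    cases M
    · exact ⟨2, _, rfl, .inl (by simp [Occurs, Inst.ownSecret, ClientTLS.view])⟩
    · exact ⟨2, _, rfl, .inl (by simp [Occurs, Inst.ownSecret, ClientTLS.view])⟩
    · exact ⟨0, _, rfl, .inr (by simp [Occurs, Inst.ownSecret, ClientTLS.view])⟩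
  | serverReg t u | serverAuth t u =>
    cases M
    · exact ⟨1, _, rfl, .inr (.inr (.inl (by simp [Occurs, Inst.ownSecret, ServerTLS.view])))⟩
    · exact ⟨1, _, rfl, .inr (.inr (.inl (by simp [Occurs, Inst.ownSecret, ServerTLS.view])))⟩
    · exact ⟨1, _, rfl, .inl (.inr (by simp [Occurs, Inst.ownSecret, ServerTLS.view]))⟩

/-! ### Signatures and secrets -/

namespace Bundle

/-- What is encrypted or signed with a non-originating key comes from a regular strand. -/
theorem NonOrig.exists_regular {P : Protocol} {B : Bundle P} {key : Msg}
    (hkey : B.NonOrig key) {b : Msg} {n : B.Node} {e : Event} (h : B.event n = some e)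
    (hc : Carried (.enc b key) e.msg) :
    ∃ k i s m, B.strand k = .regular s ∧ B.event (k, i) = some (.send m) ∧
      (P.trace s)[i]? = some (.send m) ∧ Carried (.enc b key) m := by
  rcases exists_source h (carries_singleton.2 hc) with
    ⟨k, i, s, m, hk, hm, hm', hS⟩ | ⟨k, i, p, l, m, hk, hm, hm', hl, hmS, hla⟩
  · exact ⟨k, i, s, m, hk, hm, hm', carries_singleton.1 hS⟩
  · rw [Set.mem_singleton_iff] at hmS
    subst hmS
    -- Only the `encrypt` strand builds an encryption, and it has to receive the key.
    cases hl
    obtain ⟨-, j, hj⟩ := hla key (by simp)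
    exact absurd .refl (hkey _ _ hj)

/-- A hash is secret if it depends on a secret and no regular strand sends it. -/
theorem NonOrig.hash {P : Protocol} {B : Bundle P} {t m : Msg} (ht : B.NonOrig t)
    (htm : Carried t m)
    (hreg : ∀ s (i : ℕ) m', (P.trace s)[i]? = some (.send m') → ¬ Carried (.hash m) m') :
    B.NonOrig (.hash m) := by
  intro n e h hc
  rcases exists_source h (carries_singleton.2 hc) with
    ⟨k, i, s, m', hk, hm, hm', hS⟩ | ⟨k, i, p, l, m', hk, hm, hm', hl, hmS, hla⟩
  · exact hreg s i m' hm' (carries_singleton.1 hS)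
  · rw [Set.mem_singleton_iff] at hmS
    subst hmS
    cases hl
    obtain ⟨-, j, hj⟩ := hla m (by simp)
    exact ht _ _ hj htm

variable {M : Model} {B : Bundle (uaf M)}

/-- The single node of a `rndx` strand generates its secret, which would place the generation of `r`
on a penetrator strand. -/
theorem UniqGenOn.ne_rndx {P : Protocol} {B : Bundle P} {r r' : Rndx} {k l : Fin B.size} {i : ℕ}
    {s : P.Inst} (h : B.UniqGenOn r k) (hk : B.strand k = .regular s)
    (hl : B.strand l = .penetrator (.rndx r')) (hi : B.event (l, i) = some (.send (.expt (rx r')))) :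
    r' ≠ r := by
  rintro rfl
  have hi0 : i = 0 := by
    have := (event_eq_some.1 hi).2
    rw [hl] at this
    rcases i with _ | i
    · rfl
    · simp [Strand.trace, Pen.trace] at this
  subst hi0
  have : l = k := h.eq (i := 0) ⟨⟨_, hi, by simp [Occurs]⟩, by simp⟩
  rw [this, hk] at hl
  cases hl

/-- The Diffie-Hellman values that involve the secrets of two different regular strands stay
secret. -/
theorem nonOrig_dh {kx ky : Fin B.size} {sx sy : Inst} {x y : Rndx}
    (hkx : B.strand kx = .regular sx) (hky : B.strand ky = .regular sy)
    (hx : B.UniqGenOn x kx) (hy : B.UniqGenOn y ky) (hne : kx ≠ ky)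
    {e : Expt} (hex : e x ≠ 0) (hey : e y ≠ 0) : B.NonOrig (.dh e) := by
  have hxy : x ≠ y := by
    rintro rfl
    exact hne (hy.unique hx)
  -- The exponents are included so that the complement of `S` is closed under the penetrator's
  -- operations: an exponent free of `x` and `y` leaves both coordinates of a DH value unchanged, so
  -- no cancellation can help.
  let S : Set Msg := {t | (∃ e : Expt, t = .dh e ∧ e x ≠ 0 ∧ e y ≠ 0) ∨
    ∃ e : Expt, t = .expt e ∧ (e x ≠ 0 ∨ e y ≠ 0)}
  intro n ev h hc
  rcases exists_source (S := S) h ⟨_, .inl ⟨e, rfl, hex, hey⟩, hc⟩ with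
    ⟨k, i, s, m, hk, hm, hm', t, ht, hc⟩ | ⟨k, i, p, l, m, hk, hm, hm', hl, hmS, hla⟩
  · rcases ht with ⟨f, rfl, hfx, hfy⟩ | ⟨f, rfl, -⟩
    · obtain rfl := Inst.eq_of_carried_dh hm' hc
      -- A regular strand sends `g` raised to one atomic secret, which cannot involve both `x` and
      -- `y`.
      exact hxy ((rx_apply_ne_zero.1 hfx).symm.trans (rx_apply_ne_zero.1 hfy))
    · exact Inst.not_carried_expt hm' hc
  · have hexpt : ∀ f : Expt, .expt f ∈ l → f x = 0 ∧ f y = 0 := fun f hf => by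
      by_contra hcon
      refine (hla _ hf).1 ⟨_, .inr ⟨f, rfl, ?_⟩, .refl⟩
      tauto
    have hdh : ∀ f : Expt, .dh f ∈ l → f x = 0 ∨ f y = 0 := fun f hf => by
      by_contra hcon
      refine (hla _ hf).1 ⟨_, .inl ⟨f, rfl, ?_⟩, .refl⟩
      tauto
    cases hl <;> simp [S] at hmS hexpt hdh
    case rndx r =>
      have hmS' : r = x ∨ r = y := by
        simpa [← rx_apply_ne_zero] using hmS
      rcases hmS' with h | h
      · exact hx.ne_rndx hkx hk hm h
      · exact hy.ne_rndx hky hk hm h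
    all_goals simp_all

end Bundle
-- Agreement on the TLS context
theorem Occurs.of_carried {r : Rndx} {t m : Msg} (ht : Occurs r t) (h : Carried t m) :
    Occurs r m := by
  induction h with
  | refl => exact ht
  | left _ ih => exact .inl ih
  | right _ ih => exact .inr ih
  | body _ ih => exact .inl ih

theorem fullHeight_pos (M : Model) : 4 < fullHeight M := by
  cases M <;> simp [fullHeight]

namespace Bundle

variable {M : Model} {B : Bundle (uaf M)}

theorem event_regular {k : Fin B.size} {s : Inst} (hk : B.strand k = .regular s) {i : ℕ}
    {e : Event} : B.event (k, i) = some e ↔ i < B.height k ∧ (s.trace M)[i]? = some e := by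
  rw [event_eq_some]
  simp only [hk]
  rfl

/-- Freshness declarations bind only once the secret has occurred; full execution guarantees that it
has. -/
theorem RespectsRoles.uniqGenOn (hB : B.RespectsRoles) {k : Fin B.size} {s : Inst}
    (hk : B.strand k = .regular s) (hh : fullHeight M ≤ B.height k) :
    B.UniqGenOn s.ownSecret k := by
  refine hB k s hk _ rfl ?_
  obtain ⟨i, e, he, ho⟩ := s.exists_occurs_ownSecret M
  exact ⟨i, e, (event_regular hk).2 ⟨(Inst.lt_fullHeight he).trans_le hh, he⟩, ho⟩

/-- Two servers with the same randoms are the same if the server random is unique. -/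
theorem UniqOrigOn.eq_server {k l : Fin B.size} {s s' : Inst} {m : Msg}
    (h : B.UniqOrigOn (.rand s.tls.sr) k)
    (hk : B.strand k = .regular s) (hs : s.side = .server)
    (hl : B.strand l = .regular s') (hs' : s'.side = .server)
    (hcr : s'.tls.cr = s.tls.cr) (hsr : s'.tls.sr = s.tls.sr)
    (hm : B.event (l, 1) = some (.send m)) : l = k := by
  -- The server receives `cr` first. If `sr` were equal to it, `sr` could not originate on `k`.
  have hne : s.tls.sr ≠ s.tls.cr := by
    intro heq
    obtain ⟨i, ⟨⟨a, ha, -⟩, hlt⟩, -⟩ := h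
    obtain ⟨m₀, hm₀, hc⟩ := Inst.exists_trace_zero_of_server (M := M) hs
    have h0 : B.event (k, 0) = some (.recv m₀) :=
      (event_regular hk).2 ⟨B.height_pos k, hm₀⟩
    rcases i with _ | i
    · simp [h0] at ha
    · exact hlt 0 (Nat.succ_pos i) _ h0 (heq ▸ hc)
  have hm' : (s'.trace M)[1]? = some (.send m) := ((event_regular hl).1 hm).2
  -- The only message before the server's flight carries no random but `cr`, so `sr` originates on
  -- `l` as well.
  refine h.eq (i := 1) ⟨⟨m, hm, hsr ▸ Inst.carried_sr hs' hm'⟩, fun i hi e he hc => ?_⟩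
  obtain rfl : i = 0 := by simpa using hi
  have he' : (s'.trace M)[0]? = some e := ((event_regular hl).1 he).2
  exact hne ((Inst.eq_cr_of_carried he' hc).trans hcr)

/-- The TLS 1.2 write keys of a client are secret if its peer is a regular server. -/
theorem nonOrig_swk12 {kx ky : Fin B.size} {sx sy : Inst} {x y : Rndx}
    (hkx : B.strand kx = .regular sx) (hky : B.strand ky = .regular sy)
    (hx : B.UniqGenOn x kx) (hy : B.UniqGenOn y ky) (hne : kx ≠ ky)
    {t : TLS} (htx : t.x = rx x) (hty : t.y = rx y) : B.NonOrig t.swk12 := by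
  have hxy : x ≠ y := by
    rintro rfl
    exact hne (hy.unique hx)
  have hshared : B.NonOrig t.shared := by
    refine nonOrig_dh hkx hky hx hy hne ?_ ?_ <;>
      simp [htx, hty, rx, hxy, hxy.symm]
  -- Secrecy climbs the key schedule: each hash has the previous secret as its first component.
  have hmaster : B.NonOrig t.master12 :=
    hshared.hash (.left .refl) fun s i m h hc => Inst.not_carried_master12 h hc
  exact hmaster.hash (.left .refl) fun s i m h hc => Inst.not_carried_swk12 h hc

/-- The handshake of a client in TLS 1.2 that accepts the challenge of the server `k`. -/
theorem tlsContext_of_ne_exporter (hM : M ≠ .exporterTLS13) (hB : B.RespectsRoles)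
    {k k' : Fin B.size} {t : ServerTLS} {u : AuthVars} {t' : ClientTLS} {u' : AuthVars}
    (hk : B.strand k = .regular (Inst.serverAuth t u : Inst))
    (hk' : B.strand k' = .regular (Inst.clientAuth t' u' : Inst))
    (hh' : fullHeight M ≤ B.height k')
    (hkey : B.NonOrig (.akey (t.view.key M).inv))
    (hsr : B.UniqOrigOn (.rand t.sr) k) (hch : B.UniqOrigOn (.text u.challenge) k)
    (hcert : t.view.certificate M = t'.view.certificate M)
    (hcc : u.challenge = u'.challenge) : TLSContext t.view t'.view := by
  have hpos := fullHeight_pos M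
  obtain ⟨hserver, hkk, hca⟩ : t.view.server = t'.view.server ∧ t.view.key M = t'.view.key M ∧
      t.view.ca = t'.view.ca := by
    simp [TLS.certificate] at hcert
    tauto
  -- the signed key exchange message
  obtain ⟨m₁, hm₁, hc₁⟩ := Inst.exists_trace_clientAuth_one_of_ne hM t' u'
  have he₁ : B.event (k', 1) = some (.recv m₁) :=
    (event_regular hk').2 ⟨by omega, hm₁⟩
  rw [TLS.keyExchangeSig, ← hkk] at hc₁
  obtain ⟨l, i, s, m, hl, hm, hm', hc⟩ := hkey.exists_regular he₁ hc₁
  obtain ⟨hs, rfl, hscr, hssr, hsy, -⟩ := Inst.keyExchangeSig_of_carried hm' hc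
  -- The signing server need not be complete; it has sent its DH value, which is enough for its
  -- declaration to apply.
  have hy : B.UniqGenOn s.ownSecret l := by
    refine hB l s hl _ rfl ⟨1, _, hm, Occurs.of_carried ?_ hc⟩
    refine .inl (.inr (.inr ?_))
    change t'.view.y (Inst.ownSecret s) ≠ 0
    rw [← hsy, Inst.tls_y_of_server hs]
    exact rx_apply_ne_zero.2 rfl
  have hx := hB.uniqGenOn hk' hh'
  have hne : k' ≠ l := by
    rintro rfl
    rw [hk'] at hl
    cases hl
    cases hs
  have hswk : B.NonOrig (t'.view.swk M) := by
    have := nonOrig_swk12 (t := t'.view) hk' hl hx hy hne rfl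
      (by rw [← hsy, Inst.tls_y_of_server hs])
    cases M
    · exact this
    · exact this
    · contradiction
  -- the challenge message
  have he₂ : B.event (k', fullHeight M - 2) =
      some (.recv (.enc (.name u'.appid ⋄ .text u'.challenge) (t'.view.swk M))) :=
    (event_regular hk').2 ⟨by omega, Inst.trace_clientAuth_challenge M t' u'⟩
  obtain ⟨l₂, i₂, s₂, m₂, hl₂, hm₂, hm₂', hc₂⟩ := hswk.exists_regular he₂ .refl
  obtain ⟨t₂, u₂, rfl, hi₂, -, hch₂, hswk₂⟩ := Inst.eq_serverAuth_of_carried hm₂' hc₂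
  -- The sender of the encrypted challenge originates that challenge, which is unique to `k`.
  have hlk₂ : l₂ = k := by
    refine hch.eq (i := i₂) ⟨⟨m₂, hm₂, ?_⟩, fun j hj e he => ?_⟩
    · exact hcc ▸ (Carried.body (.right .refl)).trans hc₂
    · have hlt : j < i₂ := hj
      exact Inst.not_carried_text ((event_regular hl₂).1 he).2 (by omega)
  subst hlk₂
  rw [hk] at hl₂
  cases hl₂
  -- Equality of write keys, peeled through two hashes. It yields only the product of the exponents;
  -- the separate factors come from identifying the signing server with `k`.
  obtain ⟨hshared, hcr', hsr'⟩ : t.view.x + t.view.y = t'.view.x + t'.view.y ∧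
      t.view.cr = t'.view.cr ∧ t.view.sr = t'.view.sr := by
    cases M
    · simpa [TLS.swk, TLS.swk12, TLS.master12, TLS.shared, and_assoc] using hswk₂
    · simpa [TLS.swk, TLS.swk12, TLS.master12, TLS.shared, and_assoc] using hswk₂
    · contradiction
  have hlk : l = l₂ := hsr.eq_server (s := Inst.serverAuth t u) hk rfl hl hs
    (hscr.trans hcr'.symm) (hssr.trans hsr'.symm) hm
  subst hlk
  rw [hk] at hl
  cases hl
  have hy' : t.view.y = t'.view.y := hsy
  refine ⟨hserver, hca, hcr', hsr', ?_, hy'⟩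
  rw [hy'] at hshared
  exact add_right_cancel hshared

/-- The signature covers both hello messages and the certificate, so its maker shares the client's
whole context. The randoms, known to agree through the channel binding, identify that maker with
`k`; no secrecy of the DH value is involved. -/
theorem tlsContext_of_exporter {B : Bundle (uaf .exporterTLS13)}
    {k k' : Fin B.size} {t : ServerTLS} {u : AuthVars} {t' : ClientTLS} {u' : AuthVars}
    (hk : B.strand k = .regular (Inst.serverAuth t u : Inst))
    (hk' : B.strand k' = .regular (Inst.clientAuth t' u' : Inst))
    (hh' : fullHeight .exporterTLS13 ≤ B.height k')
    (hkey : B.NonOrig (.akey (t.view.key .exporterTLS13).inv))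
    (hsr : B.UniqOrigOn (.rand t.sr) k)
    (hkk : t.view.key .exporterTLS13 = t'.view.key .exporterTLS13)
    (hcr : t.view.cr = t'.view.cr) (hsr' : t.view.sr = t'.view.sr) :
    TLSContext t.view t'.view := by
  obtain ⟨m₁, hm₁, hc₁⟩ := Inst.exists_trace_clientAuth_one_exporter t' u'
  have he₁ : B.event (k', 1) = some (.recv m₁) :=
    (event_regular hk').2 ⟨lt_of_lt_of_le (by simp [fullHeight]) hh', hm₁⟩
  rw [TLS.certificateVerify, ← hkk] at hc₁
  obtain ⟨l, i, s, m, hl, hm, hm', hc⟩ := hkey.exists_regular he₁ hc₁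
  obtain ⟨hs, rfl, heq⟩ := Inst.certificateVerify_of_carried hm' hc
  simp [TLS.clientHello, TLS.serverHello, TLS.certificate] at heq
  obtain ⟨⟨hscr, hsx⟩, ⟨hssr, hsy⟩, hserver, -, hca, -⟩ := heq
  have hlk : l = k := hsr.eq_server (s := Inst.serverAuth t u) hk rfl hl hs
    (hscr.trans hcr.symm) (hssr.trans hsr'.symm) hm
  subst hlk
  rw [hk] at hl
  cases hl
  exact ⟨hserver, hca, hscr, hssr, hsx, hsy⟩

/-- Every completed authentication server strand has a completed authentication client strand
that agrees with it on the session context. -/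
theorem exists_clientAuth (hB : B.RespectsRoles) {k : Fin B.size} {s : Inst}
    (hk : B.strand k = .regular s) (hh : fullHeight M ≤ B.height k)
    (ha : serverAssumptions M B k s) :
    ∃ k' s', B.strand k' = .regular s' ∧ s'.role = .clientAuth ∧ fullHeight M ≤ B.height k' ∧
      authContext M s s' := by
  obtain ⟨t, u, rfl, -, hkey, hauth, hsr, -, hch⟩ := ha
  have hpos := fullHeight_pos M
  have he : B.event (k, fullHeight M - 1) = _ :=
    (event_regular hk).2 ⟨by omega, Inst.trace_serverAuth_last M t u⟩
  obtain ⟨k', i, s', m, hk', hm, hm', hc⟩ :=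
    hauth.exists_regular he (.body (.right (.right .refl)))
  obtain ⟨t', u', rfl, hi, hfc⟩ := Inst.eq_clientAuth_of_carried hm' hc
  -- The signature is in the client's last message, so having sent it means having been fully
  -- executed.
  have hh' : fullHeight M ≤ B.height k' := by
    have : i < B.height k' := (event_eq_some.1 hm).1
    omega
  simp only [finalChallenge, Msg.hash.injEq, Msg.pair.injEq, Msg.name.injEq, Msg.text.injEq] at hfc
  obtain ⟨happ, hcc, htls⟩ := hfc
  have hctx : TLSContext t.view t'.view := by
    cases M with
    | endpointTLS12DH =>
      refine tlsContext_of_ne_exporter (by simp) hB hk hk' hh' hkey hsr hch ?_ hcc.symm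
      simp only [tlsData, Msg.hash.injEq, Msg.pair.injEq] at htls
      exact htls.2.2.symm
    | serverCertTLS12DH =>
      refine tlsContext_of_ne_exporter (by simp) hB hk hk' hh' hkey hsr hch ?_ hcc.symm
      simp only [tlsData, Msg.hash.injEq, Msg.pair.injEq] at htls
      exact htls.2.2.symm
    | exporterTLS13 =>
      simp only [tlsData, Msg.hash.injEq, Msg.pair.injEq, Msg.rand.injEq, Msg.akey.injEq] at htls
      exact tlsContext_of_exporter hk hk' hh' hkey hsr htls.2.2.2.2.symm htls.2.2.1.symm
        htls.2.2.2.1.symm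
  exact ⟨k', _, hk', rfl, hh', hctx, hcc.symm, hctx.1, happ.symm⟩

/-- Two fully executed strands with the same secret are the same. -/
theorem RespectsRoles.eq_of_ownSecret (hB : B.RespectsRoles) {k l : Fin B.size} {s s' : Inst}
    (hk : B.strand k = .regular s) (hl : B.strand l = .regular s')
    (hh : fullHeight M ≤ B.height k) (hh' : fullHeight M ≤ B.height l)
    (h : s.ownSecret = s'.ownSecret) : l = k :=
  (hB.uniqGenOn hk hh).unique (h ▸ hB.uniqGenOn hl hh')

end Bundle

/-! ### Injective agreement -/

/-- Agreement on `x` and `y` includes agreement on a strand's own secret. A competing client side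
strand shares `x` with `k'` and so equals it; a server side one shares `y` with `k`, which is
excluded. -/
theorem injectiveAgreement (M : Model) :
    InjectiveAgreement (uaf M) Role.serverAuth Role.clientAuth (authContext M)
      (serverAssumptions M) := by
  intro B hB k s hk hs hh ha
  obtain ⟨k', s', hk', hs', hh', hctx⟩ := B.exists_clientAuth hB hk hh ha
  obtain ⟨t, u, rfl, -⟩ := ha
  obtain ⟨t', u', rfl⟩ : ∃ t' u', s' = Inst.clientAuth t' u' := by
    cases s' <;> simp [Inst.role] at hs'
    exact ⟨_, _, rfl⟩
  refine ⟨k', _, hk', rfl, trivial, hh', hctx, fun l s'' hl hne hhl hctx' => ?_⟩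
  obtain ⟨⟨-, -, -, -, hx, -⟩, -⟩ := hctx
  obtain ⟨⟨-, -, -, -, hx', hy'⟩, -⟩ := hctx'
  rcases hside : Inst.side s'' with _ | _
  · refine hB.eq_of_ownSecret hk' hl hh' hhl (rx_injective ?_)
    rw [← Inst.tls_x_of_client hside, ← Inst.tls_x_of_client rfl, ← hx, ← hx']
  · refine absurd (hB.eq_of_ownSecret hk hl hh hhl (rx_injective ?_)) hne
    rw [← Inst.tls_y_of_server hside, ← Inst.tls_y_of_server rfl, ← hy']

/-! ### An honest session

A bundle that satisfies the server assumptions: one client and one server, and no penetrator. -/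

namespace Honest

def side : Fin 2 → Side
  | 0 => .client
  | 1 => .server

/-- The randoms are distinct so that `sr` can originate with a server that has already received
`cr`, and the secrets are distinct so that each is generated by its own end. -/
noncomputable def client : ClientTLS := ⟨0, 1, ⟨.free 0, false⟩, 0, 1, 0, rx 1⟩

noncomputable def server : ServerTLS := ⟨0, 1, ⟨.free 0, false⟩, 0, 1, rx 0, 1⟩

def vars : AuthVars := ⟨0, 0, ⟨.free 1, false⟩, 2⟩

noncomputable def inst : Fin 2 → Inst
  | 0 => .clientAuth client vars
  | 1 => .serverAuth server vars

noncomputable def messages (M : Model) : List (Side × Msg) :=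
  server.view.handshake M ++ authMessages M server.view vars

/-- Client and server have the same view of the session, so both traces are one list of messages
read from two sides. -/
theorem trace_inst (M : Model) (k : Fin 2) :
    (inst k).trace M = (messages M).map (eventAt (side k)) := by
  fin_cases k <;> rfl

theorem trace_inst_eq_some {M : Model} {k : Fin 2} {i : ℕ} {e : Event} :
    ((inst k).trace M)[i]? = some e ↔
      ∃ d m, (messages M)[i]? = some (d, m) ∧ eventAt (side k) (d, m) = e := by
  simp [trace_inst]

theorem eventAt_msg (a d : Side) (m : Msg) : (eventAt a (d, m)).msg = m := by
  cases a <;> cases d <;> rfl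

theorem eventAt_eq_send {k : Fin 2} {d : Side} {m m' : Msg} :
    eventAt (side k) (d, m) = .send m' ↔ d = side k ∧ m = m' := by
  fin_cases k <;> cases d <;> simp [side, eventAt]

theorem eventAt_eq_recv {k : Fin 2} {d : Side} {m m' : Msg} :
    eventAt (side k) (d, m) = .recv m' ↔ d ≠ side k ∧ m = m' := by
  fin_cases k <;> cases d <;> simp [side, eventAt]

theorem side_injective {k l : Fin 2} (h : side k = side l) : k = l := by
  fin_cases k <;> fin_cases l <;> simp [side] at h ⊢

theorem exists_side_eq (d : Side) : ∃ k, side k = d := by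
  cases d
  · exact ⟨0, rfl⟩
  · exact ⟨1, rfl⟩

/-- The position of an event in the order of the session. -/
noncomputable def rank (M : Model) (a : Fin 2 × ℕ) : ℕ :=
  open Classical in
  2 * a.2 + if ∃ m, ((inst a.1).trace M)[a.2]? = some (.recv m) then 1 else 0

/-- Since both ends number the messages alike, a transmission is matched with the reception at the
same position of the other strand. -/
noncomputable def bundle (M : Model) : Bundle (uaf M) where
  size := 2
  strand k := .regular (inst k)
  height _ := fullHeight M
  height_pos _ := (Nat.zero_le 4).trans_lt (fullHeight_pos M)
  height_le k := (Inst.length_trace M (inst k)).ge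
  comm a b := a.1 ≠ b.1 ∧ a.2 = b.2 ∧ a.2 < fullHeight M ∧
    ∃ m, ((inst a.1).trace M)[a.2]? = some (.send m) ∧ ((inst b.1).trace M)[b.2]? = some (.recv m)
  comm_spec := fun _ _ ⟨hne, heq, hlt, h⟩ => ⟨hlt, heq ▸ hlt, hne, h⟩
  recv_unique := by
    rintro ⟨l, i⟩ m hi hm
    obtain ⟨d, m', hmi, he⟩ := trace_inst_eq_some.1 hm
    obtain ⟨hd, rfl⟩ := eventAt_eq_recv.1 he
    obtain ⟨k, rfl⟩ := exists_side_eq d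
    refine ⟨(k, i), ⟨fun h => hd (congrArg side h), rfl, hi, m', ?_, hm⟩, ?_⟩
    · exact trace_inst_eq_some.2 ⟨_, _, hmi, eventAt_eq_send.2 ⟨rfl, rfl⟩⟩
    · rintro ⟨k', i'⟩ ⟨-, rfl, -, m'', hs, -⟩
      obtain ⟨d, m₁, hmi', he'⟩ := trace_inst_eq_some.1 hs
      obtain ⟨rfl, rfl⟩ := eventAt_eq_send.1 he'
      rw [hmi] at hmi'
      simp only [Option.some.injEq, Prod.mk.injEq] at hmi'
      rw [side_injective hmi'.1]
  acyclic := by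
    intro a h
    -- A delivery goes from rank `2 * i` to `2 * i + 1`, and a step along a strand raises the
    -- position, so every edge increases the rank.
    have h' := h.lift (p := (· < ·)) (rank M) fun a b hab => by
      obtain ⟨k, i⟩ := a
      obtain ⟨l, j⟩ := b
      change rank M (k, i) < rank M (l, j)
      rcases hab with ⟨-, rfl, -, m, hs, hr⟩ | ⟨-, rfl, -⟩
      · dsimp only at hs hr
        simp [rank, hs, hr]
      · unfold rank
        dsimp only
        split_ifs <;> omega
    rw [Relation.transGen_eq_self] at h'
    exact lt_irrefl _ h'

theorem event_eq_some {M : Model} {k : Fin 2} {i : ℕ} {e : Event} :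
    (bundle M).event (k, i) = some e ↔
      ∃ d m, (messages M)[i]? = some (d, m) ∧ eventAt (side k) (d, m) = e := by
  rw [← trace_inst_eq_some]
  exact (Bundle.event_regular (B := bundle M) (k := k) (s := inst k) rfl).trans
    ⟨And.right, fun h => ⟨Inst.lt_fullHeight h, h⟩⟩

theorem nonOrig {M : Model} {t : Msg} (h : ∀ p ∈ messages M, ¬ Carried t p.2) :
    (bundle M).NonOrig t := by
  rintro ⟨k, i⟩ e he
  obtain ⟨d, m, hm, rfl⟩ := event_eq_some.1 he
  rw [eventAt_msg]
  exact h _ (List.mem_of_getElem? hm)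

/-- Freshness is read off the common message list: with `Q` as `Carried t` or `Occurs r`, this is
exactly unique origination or unique generation. -/
theorem exists_unique_firstSend {M : Model} {Q : Msg → Prop} {i : ℕ} {k : Fin 2} {m : Msg}
    (h : (messages M)[i]? = some (side k, m)) (hQ : Q m)
    (hlt : ∀ p ∈ (messages M).take i, ¬ Q p.2) :
    ∃ i, (bundle M).FirstSend Q (k, i) ∧ ∀ n, (bundle M).FirstSend Q n → n = (k, i) := by
  have hlt' : ∀ j < i, ∀ d m, (messages M)[j]? = some (d, m) → ¬ Q m := fun j hj d m hm =>
    hlt (d, m) (List.mem_of_getElem? (i := j) (by rw [List.getElem?_take_of_lt hj, hm]))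
  refine ⟨i, ⟨⟨m, ?_, hQ⟩, fun j hj e he => ?_⟩, ?_⟩
  · exact event_eq_some.2 ⟨_, _, h, eventAt_eq_send.2 ⟨rfl, rfl⟩⟩
  · obtain ⟨d, m', hm', rfl⟩ := event_eq_some.1 he
    rw [eventAt_msg]
    exact hlt' j hj d m' hm'
  · rintro ⟨l, j⟩ ⟨⟨m', hm', hQ'⟩, hfirst⟩
    obtain ⟨d, m₁, hmj, he⟩ := event_eq_some.1 hm'
    obtain ⟨rfl, rfl⟩ := eventAt_eq_send.1 he
    rcases lt_trichotomy j i with hj | rfl | hj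
    · exact absurd hQ' (hlt' j hj _ _ hmj)
    · rw [h] at hmj
      simp only [Option.some.injEq, Prod.mk.injEq] at hmj
      obtain rfl := side_injective hmj.1
      rfl
    -- Whichever strand `l` is, it has already sent or received message `i`, so a later transmission
    -- is not its first with `Q`.
    · refine absurd ?_ (hfirst i hj _ (event_eq_some.2 ⟨_, _, h, rfl⟩))
      rwa [eventAt_msg]

theorem uniqGenOn_ownSecret (M : Model) (k : Fin 2) :
    (bundle M).UniqGenOn (inst k).ownSecret k := by
  have h01 : rx 0 1 = 0 := by simp [rx]
  have h10 : rx 1 0 = 0 := by simp [rx]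
  fin_cases k
  · cases M
    · refine exists_unique_firstSend (k := 0) (i := 2) rfl
        (.inl (rx_apply_ne_zero.2 rfl)) ?_
      simp [messages, TLS.handshake, TLS.handshake12, TLS.certificate, TLS.keyExchangeSig,
        Occurs, inst, Inst.ownSecret, client, server, ServerTLS.view, h10]
    · refine exists_unique_firstSend (k := 0) (i := 2) rfl
        (.inl (rx_apply_ne_zero.2 rfl)) ?_
      simp [messages, TLS.handshake, TLS.handshake12, TLS.certificate, TLS.keyExchangeSig,
        Occurs, inst, Inst.ownSecret, client, server, ServerTLS.view, h10]
    · exact exists_unique_firstSend (k := 0) (i := 0) rfl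
        (.inr (rx_apply_ne_zero.2 rfl)) (by simp)
  · cases M
    · refine exists_unique_firstSend (k := 1) (i := 1) rfl
        (.inr (.inr (.inl (rx_apply_ne_zero.2 rfl)))) ?_
      simp [messages, TLS.handshake, TLS.handshake12, Occurs]
    · refine exists_unique_firstSend (k := 1) (i := 1) rfl
        (.inr (.inr (.inl (rx_apply_ne_zero.2 rfl)))) ?_
      simp [messages, TLS.handshake, TLS.handshake12, Occurs]
    · refine exists_unique_firstSend (k := 1) (i := 1) rfl
        (.inl (.inr (rx_apply_ne_zero.2 rfl))) ?_
      simp [messages, TLS.handshake, TLS.handshake13, TLS.clientHello, Occurs, inst,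
        Inst.ownSecret, server, ServerTLS.view, h01]

theorem respectsRoles (M : Model) : (bundle M).RespectsRoles := by
  intro k s hk r hr _
  cases hk
  cases hr
  exact uniqGenOn_ownSecret M k

theorem uniqOrigOn_sr (M : Model) : (bundle M).UniqOrigOn (.rand server.sr) (1 : Fin 2) := by
  cases M
  · refine exists_unique_firstSend (k := 1) (i := 1) rfl (.left .refl) ?_
    simp [messages, TLS.handshake, TLS.handshake12, server, ServerTLS.view]
  · refine exists_unique_firstSend (k := 1) (i := 1) rfl (.left .refl) ?_
    simp [messages, TLS.handshake, TLS.handshake12, server, ServerTLS.view]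
  · refine exists_unique_firstSend (k := 1) (i := 1) rfl (.left (.left .refl)) ?_
    simp [messages, TLS.handshake, TLS.handshake13, TLS.clientHello, server, ServerTLS.view]

theorem uniqOrigOn_challenge (M : Model) : (bundle M).UniqOrigOn (.text vars.challenge) (1 : Fin 2) := by
  cases M
  · refine exists_unique_firstSend (k := 1) (i := 4) rfl (.body (.right .refl)) ?_
    simp [messages, TLS.handshake, TLS.handshake12, TLS.certificate, TLS.keyExchangeSig,
      TLS.clientFinished12, TLS.serverFinished12]
  · refine exists_unique_firstSend (k := 1) (i := 4) rfl (.body (.right .refl)) ?_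
    simp [messages, TLS.handshake, TLS.handshake12, TLS.certificate, TLS.keyExchangeSig,
      TLS.clientFinished12, TLS.serverFinished12]
  · refine exists_unique_firstSend (k := 1) (i := 3) rfl (.body (.right .refl)) ?_
    simp [messages, TLS.handshake, TLS.handshake13, TLS.clientHello, TLS.serverHello,
      TLS.certificate, TLS.certificateVerify, TLS.clientFinished13, TLS.serverFinished13]

/-- The only key carried in the session is the server's public key in its certificate; private keys
appear as signing keys, which are not carried. -/
theorem nonOrig_of_priv {M : Model} {k : AKey} (hk : k.priv = true) :
    (bundle M).NonOrig (.akey k) := by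
  refine nonOrig fun p hp hc => ?_
  cases M <;> simp [messages, TLS.handshake, TLS.handshake12, TLS.handshake13, authMessages] at hp
  all_goals
    rcases hp with rfl | rfl | rfl | rfl | rfl | rfl
  all_goals
    simp [TLS.clientHello, TLS.serverHello, TLS.certificate, TLS.keyExchangeSig,
      TLS.clientFinished12, TLS.clientFinished13, TLS.serverFinished12, TLS.serverFinished13,
      TLS.certificateVerify, finalChallenge] at hc
  all_goals
    subst hc
    simp [TLS.key, pubk, server, ServerTLS.view] at hk

theorem serverAssumptions_bundle (M : Model) :
    serverAssumptions M (bundle M) (1 : Fin 2) (inst 1) :=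
  ⟨server, vars, rfl, nonOrig_of_priv rfl, nonOrig_of_priv (by cases M <;> rfl),
    nonOrig_of_priv rfl, uniqOrigOn_sr M, uniqGenOn_ownSecret M 1, uniqOrigOn_challenge M⟩

end Honest

/-! ### Uniqueness of the role and session context agreement -/

/-- Applied to the honest session, `Succ` yields an actual strand of role `R`, and `clientAuth` is
the only role complementary to `serverAuth`. -/
theorem eq_clientAuth_of_succ {M : Model} {R : Role} {j : ℕ}
    (h : Succ (uaf M) Role.serverAuth R (authContext M) (serverAssumptions M) (fullHeight M) j) :
    R = .clientAuth := by
  obtain ⟨-, s', -, hs', hc, -⟩ := h (Honest.bundle M) (Honest.respectsRoles M) (1 : Fin 2) (Honest.inst 1)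
    rfl rfl le_rfl (Honest.serverAssumptions_bundle M)
  rw [hs'] at hc
  cases R <;> first | rfl | cases hc

theorem sessionContextAgreement (M : Model) :
    SessionContextAgreement (uaf M) Role.serverAuth Role.clientAuth (authContext M)
      (serverAssumptions M) := by
  refine ⟨fullHeight M, le_rfl, fun B hB k s hk hs hh ha => ?_, fun R R' h => ?_⟩
  · obtain ⟨k', s', hk', hs', -, hh', hctx, -⟩ := injectiveAgreement M B hB k s hk hs hh ha
    exact ⟨k', s', hk', hs', by rw [hs, hs']; trivial, hh', hctx⟩
  · exact (eq_clientAuth_of_succ h.1).trans (eq_clientAuth_of_succ h.2).symm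

end UAF

theorem theorem6 (M : UAF.Model) :
    UAF.SessionContextAgreement (UAF.uaf M) UAF.Role.serverAuth UAF.Role.clientAuth
        (UAF.authContext M) (UAF.serverAssumptions M) ∧
      UAF.InjectiveAgreement (UAF.uaf M) UAF.Role.serverAuth UAF.Role.clientAuth
        (UAF.authContext M) (UAF.serverAssumptions M) :=
  ⟨UAF.sessionContextAgreement M, UAF.injectiveAgreement M⟩
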